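/- Let $\mathfrak g$ be a finite-dimensional real Lie algebra that is solvable and unimodular ($\operatorname{tr}(\operatorname{ad}_x)=0$ for all $x\in\mathfrak g$). 1. If $\mathfrak g$ carries a Vaisman structure, then $\mathfrak g$ admits a complete left-symmetric algebra (LSA) structure. 2. If $\mathfrak g$ carries a Sasakian structure, then $\mathfrak g$ admits a complete LSA structure. Here $d$ is the Chevalley--Eilenberg differential with trivial coefficients, so $d\eta(x,y)=-\eta([x,y])$ for $\eta\in\mathfrak g^*$. A *Vaisman structure* is a pair $(J,\langle\cdot,\cdot\rangle)$ of an endomorphism $J$ with $J^2=-\operatorname{Id}$ and $[Jx,Jy]-[x,y]-J([Jx,y]+[x,Jy])=0$, and an inner product with $\langle Jx,Jy\rangle=\langle x,y\rangle$, such that for $\omega(x,y)=\langle Jx,y\rangle$ there is $\theta\in\mathfrak g^*$ with $d\theta=0$, $d\omega=\theta\wedge\omega$ and $\nabla\theta=0$, where $\nabla$ is the Levi-Civita connection of $\langle\cdot,\cdot\rangle$. A *Sasakian structure* is a quadruple $(\langle\cdot,\cdot\rangle,\phi,\xi,\eta)$ of an inner product, an endomorphism $\phi$, a vector $\xi\in\mathfrak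 g$ and a form $\eta\in\mathfrak g^*$ such that $\eta(\xi)=1$, $\phi^2=-\operatorname{Id}+\eta\otimes\xi$, $\langle\phi x,\phi y\rangle=\langle x,y\rangle-\eta(x)\eta(y)$, $[\phi x,\phi y]+\phi^2[x,y]-\phi([\phi x,y]+[x,\phi y])=-d\eta(x,y)\,\xi$, and $d\eta(x,y)=-\langle\phi x,y\rangle$. (Up to rescaling, the last equation may be replaced by $d\eta(x,y)=2\langle\phi x,y\rangle$.) An *LSA structure* on $\mathfrak g$ is a bilinear product $x\cdot y$ on $\mathfrak g$ with $[x,y]=x\cdot y-y\cdot x$ and $x\cdot(y\cdot z)-(x\cdot y)\cdot z=y\cdot(x\cdot z)-(y\cdot x)\cdot z$; it is *complete* if the map $y\mapsto y+y\cdot x$ is bijective for every $x\in\mathfrak g$. -/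

import Mathlib

namespace LieStr

variable {g : Type*} [LieRing g] [LieAlgebra ℝ g]

/-- A Lie algebra is unimodular if every adjoint operator has trace zero. -/
def IsUnimodular (g : Type*) [LieRing g] [LieAlgebra ℝ g] : Prop :=
  ∀ x : g, LinearMap.trace ℝ g (LieAlgebra.ad ℝ g x) = 0

/-! ### The low degree differentials of the Chevalley-Eilenberg complex (trivial coefficients) -/

/-- The differential of a `1`-form: `dη(x, y) = -η[x, y]`. -/
def dOne (η : Module.Dual ℝ g) (x y : g) : ℝ := -η ⁅x, y⁆

/-- The differential of a `2`-form:
`dω(x, y, z) = -ω([x, y], z) - ω([y, z], x) - ω([z, x], y)`. -/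
def dTwo (ω : g → g → ℝ) (x y z : g) : ℝ := -ω ⁅x, y⁆ z - ω ⁅y, z⁆ x - ω ⁅z, x⁆ y

/-- The wedge product of a `1`-form and a `2`-form. -/
def wedgeOneTwo (θ : Module.Dual ℝ g) (ω : g → g → ℝ) (x y z : g) : ℝ :=
  θ x * ω y z + θ y * ω z x + θ z * ω x y

/-- `dOne` agrees with Mathlib's coboundary operator for the trivial module `ℝ`. -/
theorem dOne_eq (η : Module.Dual ℝ g) (x y : g) :
    dOne η x y =
      LieModule.Cohomology.d₁₂ ℝ g (TrivialLieModule ℝ g ℝ)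
        ((TrivialLieModule.equiv ℝ g ℝ).symm.toLinearMap ∘ₗ η) x y := by
  rw [LieModule.Cohomology.d₁₂_apply_apply_ofTrivial]
  rfl

/-- `dTwo` agrees with Mathlib's coboundary operator for the trivial module `ℝ`. -/
theorem dTwo_eq (ω : LieModule.Cohomology.twoCochain ℝ g (TrivialLieModule ℝ g ℝ)) (x y z : g) :
    dTwo (fun u v => TrivialLieModule.equiv ℝ g ℝ (ω u v)) x y z =
      TrivialLieModule.equiv ℝ g ℝ
        (LieModule.Cohomology.d₂₃ ℝ g (TrivialLieModule ℝ g ℝ) ω x y z) := by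
  have h : ω ⁅z, x⁆ y = -ω ⁅x, z⁆ y := by
    rw [← lie_skew z x, map_neg, LinearMap.neg_apply]
  simp only [dTwo, LieModule.Cohomology.d₂₃_apply, h, trivial_lie_zero, map_sub, map_add, map_neg,
    map_zero]
  ring

/-! ### Inner products and the Levi-Civita connection -/

/-- An inner product on a real vector space: a symmetric positive definite bilinear form. -/
structure IsInnerProduct (B : LinearMap.BilinForm ℝ g) : Prop where
  symm : ∀ x y, B x y = B y x
  pos : ∀ x, x ≠ 0 → 0 < B x x

theorem IsInnerProduct.nondegenerate {B : LinearMap.BilinForm ℝ g} (hB : IsInnerProduct B) :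
    B.Nondegenerate := by
  refine ⟨fun x hx => ?_, fun x hx => ?_⟩ <;>
  · by_contra h
    exact (hB.pos x h).ne' (hx x)

/-- The right-hand side of the Koszul formula for left invariant vector fields, as a function
of the third argument. -/
noncomputable def koszul (B : LinearMap.BilinForm ℝ g) (x y : g) : Module.Dual ℝ g where
  toFun z := (1 / 2) * (B ⁅x, y⁆ z - B ⁅y, z⁆ x + B ⁅z, x⁆ y)
  map_add' := by intros; simp; ring
  map_smul' := by intros; simp; ring

/-- The Levi-Civita connection `x ↦ y ↦ ∇_x y` of the inner product `B` on the Lie algebra `g`: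
the solution of the Koszul formula `B (∇_x y) z = koszul B x y z`. -/
noncomputable def leviCivita [FiniteDimensional ℝ g] (B : LinearMap.BilinForm ℝ g)
    (hB : IsInnerProduct B) : g →ₗ[ℝ] g →ₗ[ℝ] g :=
  LinearMap.mk₂ ℝ (fun x y => (B.toDual hB.nondegenerate).symm (koszul B x y))
    (by intros; rw [← map_add]; congr 1; ext z; simp [koszul]; ring)
    (by intros; rw [← map_smul]; congr 1; ext z; simp [koszul]; ring)
    (by intros; rw [← map_add]; congr 1; ext z; simp [koszul]; ring)
    (by intros; rw [← map_smul]; congr 1; ext z; simp [koszul]; ring)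

theorem leviCivita_koszul [FiniteDimensional ℝ g] (B : LinearMap.BilinForm ℝ g)
    (hB : IsInnerProduct B) (x y z : g) :
    B (leviCivita B hB x y) z = (1 / 2) * (B ⁅x, y⁆ z - B ⁅y, z⁆ x + B ⁅z, x⁆ y) :=
  LinearMap.BilinForm.apply_toDual_symm_apply (hB := hB.nondegenerate) (koszul B x y) z

/-- The Levi-Civita connection is torsion-free. -/
theorem leviCivita_torsion [FiniteDimensional ℝ g] (B : LinearMap.BilinForm ℝ g)
    (hB : IsInnerProduct B) (x y : g) :
    leviCivita B hB x y - leviCivita B hB y x = ⁅x, y⁆ := by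
  rw [← sub_eq_zero]
  refine hB.nondegenerate.1 _ fun z => ?_
  simp only [map_sub, LinearMap.sub_apply, leviCivita_koszul]
  have h (a b c : g) : B ⁅a, b⁆ c = -B ⁅b, a⁆ c := by
    rw [← lie_skew a b, map_neg, LinearMap.neg_apply]
  rw [h y x z, h z y x, h z x y]
  ring

/-- The Levi-Civita connection is metric. -/
theorem leviCivita_metric [FiniteDimensional ℝ g] (B : LinearMap.BilinForm ℝ g)
    (hB : IsInnerProduct B) (x y z : g) :
    B (leviCivita B hB x y) z + B y (leviCivita B hB x z) = 0 := by
  have h (a b c : g) : B ⁅a, b⁆ c = -B ⁅b, a⁆ c := by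
    rw [← lie_skew a b, map_neg, LinearMap.neg_apply]
  rw [hB.symm y, leviCivita_koszul, leviCivita_koszul, h y x z, h z y x, h z x y]
  ring

/-- `∇θ = 0`, where `(∇_x θ)(y) = -θ(∇_x y)` for left invariant `θ`, `x`, `y`. -/
def IsParallelOneForm [FiniteDimensional ℝ g] (B : LinearMap.BilinForm ℝ g)
    (hB : IsInnerProduct B) (θ : Module.Dual ℝ g) : Prop :=
  ∀ x y : g, -θ (leviCivita B hB x y) = 0

/-! ### Vaisman structures -/

/-- A complex structure on a Lie algebra: `J² = -Id` and the Nijenhuis tensor of `J` vanishes. -/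
structure IsComplexStructure (J : g →ₗ[ℝ] g) : Prop where
  sq : ∀ x, J (J x) = -x
  integrable : ∀ x y, ⁅J x, J y⁆ - ⁅x, y⁆ - J (⁅J x, y⁆ + ⁅x, J y⁆) = 0

/-- The fundamental `2`-form `(x, y) ↦ B (J x) y`. -/
def fundamentalForm (B : LinearMap.BilinForm ℝ g) (J : g →ₗ[ℝ] g) (x y : g) : ℝ := B (J x) y

/-- A Hermitian structure: a complex structure and a compatible inner product. -/
structure IsHermitianStructure (J : g →ₗ[ℝ] g) (B : LinearMap.BilinForm ℝ g) : Prop where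
  complex : IsComplexStructure J
  inner : IsInnerProduct B
  compatible : ∀ x y, B (J x) (J y) = B x y

/-- `θ` is a Lee form of `(J, B)`: `dθ = 0` and `dω = θ ∧ ω` for the fundamental form `ω`. -/
structure IsLeeForm (J : g →ₗ[ℝ] g) (B : LinearMap.BilinForm ℝ g) (θ : Module.Dual ℝ g) :
    Prop where
  closed : ∀ x y, dOne θ x y = 0
  lck : ∀ x y z,
    dTwo (fundamentalForm B J) x y z = wedgeOneTwo θ (fundamentalForm B J) x y z

/-- A Vaisman structure on a Lie algebra: a locally conformally Kähler structure with a Lee form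
that is parallel for the Levi-Civita connection. -/
def IsVaismanStructure [FiniteDimensional ℝ g] (J : g →ₗ[ℝ] g) (B : LinearMap.BilinForm ℝ g) :
    Prop :=
  ∃ h : IsHermitianStructure J B, ∃ θ : Module.Dual ℝ g,
    IsLeeForm J B θ ∧ IsParallelOneForm B h.inner θ

/-! ### Sasakian structures -/

/-- An almost contact metric structure on a Lie algebra. -/
structure IsAlmostContactMetric (B : LinearMap.BilinForm ℝ g) (φ : g →ₗ[ℝ] g) (ξ : g)
    (η : Module.Dual ℝ g) : Prop where
  inner : IsInnerProduct B
  reeb : η ξ = 1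
  sq : ∀ x, φ (φ x) = -x + η x • ξ
  compatible : ∀ x y, B (φ x) (φ y) = B x y - η x * η y

/-- Normality: `N_φ = -dη ⊗ ξ`, where
`N_φ(x, y) = [φ x, φ y] + φ²[x, y] - φ([φ x, y] + [x, φ y])`. -/
def IsNormal (φ : g →ₗ[ℝ] g) (ξ : g) (η : Module.Dual ℝ g) : Prop :=
  ∀ x y, ⁅φ x, φ y⁆ + φ (φ ⁅x, y⁆) - φ (⁅φ x, y⁆ + ⁅x, φ y⁆) = -(dOne η x y • ξ)

/-- A Sasakian structure, in the normalization `dη = -Φ` where `Φ(x, y) = B (φ x) y`. By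
`isSasakian_of_eq_two` below, the normalization `dη = 2Φ` describes the same structures up to
rescaling. -/
structure IsSasakianStructure (B : LinearMap.BilinForm ℝ g) (φ : g →ₗ[ℝ] g) (ξ : g)
    (η : Module.Dual ℝ g) : Prop where
  almostContactMetric : IsAlmostContactMetric B φ ξ η
  normal : IsNormal φ ξ η
  contact : ∀ x y, dOne η x y = -fundamentalForm B φ x y

/-- A normal almost contact metric structure with `dη = 2Φ` becomes, after rescaling, one with
`dη = -Φ`. -/
theorem isSasakian_of_eq_two {B : LinearMap.BilinForm ℝ g} {φ : g →ₗ[ℝ] g} {ξ : g}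
    {η : Module.Dual ℝ g} (h : IsAlmostContactMetric B φ ξ η) (hn : IsNormal φ ξ η)
    (hc : ∀ x y, dOne η x y = 2 * fundamentalForm B φ x y) :
    IsSasakianStructure ((4 : ℝ) • B) φ ((-(1 / 2) : ℝ) • ξ) ((-2 : ℝ) • η) := by
  refine ⟨⟨⟨fun x y => ?_, fun x hx => ?_⟩, ?_, fun x => ?_, fun x y => ?_⟩,
    fun x y => ?_, fun x y => ?_⟩
  · simp [h.inner.symm x y]
  · simpa using h.inner.pos x hx
  · simp [h.reeb]
  · rw [h.sq x, smul_smul]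
    simp only [LinearMap.smul_apply, smul_eq_mul]
    ring_nf
  · simp [h.compatible x y]
    ring
  · rw [hn x y, smul_smul]
    simp only [dOne, LinearMap.smul_apply, smul_eq_mul]
    ring_nf
  · have := hc x y
    simp only [dOne, fundamentalForm, LinearMap.smul_apply, smul_eq_mul] at this ⊢
    linarith

/-! ### Left-symmetric algebra structures -/

/-- A left-symmetric algebra (LSA) structure on a Lie algebra: a bilinear product `x · y` with
left-symmetric associator whose commutator is the Lie bracket. -/
structure IsLSAStructure (m : g →ₗ[ℝ] g →ₗ[ℝ] g) : Prop where
  commutator : ∀ x y, ⁅x, y⁆ = m x y - m y x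
  leftSymmetric : ∀ x y z, m x (m y z) - m (m x y) z = m y (m x z) - m (m y x) z

/-- An LSA structure is complete if `Id + ρ(x)` is bijective for every `x`, where
`ρ(x) y = y · x`. -/
def IsCompleteLSAStructure (m : g →ₗ[ℝ] g →ₗ[ℝ] g) : Prop :=
  IsLSAStructure m ∧ ∀ x : g, Function.Bijective fun y : g => y + m y x

end LieStr

/-! Both structures reduce to flat Kähler geometry transverse to a central vector `ξ`: the Reeb
vector, or `-J A` with `A` the rescaled Lee vector.

Centrality: `ad ξ` is skew for the metric. Unimodularity shows that the sum of the brackets `[eᵢ, J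
eᵢ]` (or `[eᵢ, φ eᵢ]`) over an orthonormal basis is a multiple of `ξ`, and the multiple is nonzero
unless the transverse space is zero. So `ξ` lies in the derived algebra, where solvability makes
`ad` nilpotent (Lie's theorem), and a skew nilpotent operator is zero.

Flatness: the transverse space `ker θ ⊓ ker η`, with the projected bracket, is a unimodular Kähler
Lie algebra whose derived algebra is ad-nilpotent. A trace identity for its Levi-Civita connection
forces the Killing trace plus half of the squared norm of the bracket to vanish. As `tr (ad z)² = 0`
on the derived algebra, this becomes a vanishing sum of squares: the derived algebra is abelian, and
so is its orthogonal complement, which acts by skew maps. Hence `∇_x y = [p x, y]`, with `p` the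
projection onto the complement.

Product: on `g` put `u · v = θ(u) D v + [p u, v] + ½ σ(u, v) ξ` (transverse parts understood), where
`D` is induced by `ad A` and `σ` is the cocycle of the central extension. `D` and `ad (p u)` commute
with `p` or are killed by it suitably, and both preserve `σ`, which gives left symmetry; `p` kills
brackets, which gives completeness. The case of zero Lee form is the Kähler case, with `A = ξ = 0`.
-/

/-! ### Nilpotency of the derived algebra of a solvable Lie algebra -/

/-- The linear span of all commutators of a Lie algebra. -/
def commutatorSpan (R L : Type*) [CommRing R] [LieRing L] [LieAlgebra R L] : Submodule R L :=
  Submodule.span R {z | ∃ x y : L, ⁅x, y⁆ = z}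

theorem lie_mem_commutatorSpan (R : Type*) {L : Type*} [CommRing R] [LieRing L] [LieAlgebra R L]
    (x y : L) : ⁅x, y⁆ ∈ commutatorSpan R L :=
  Submodule.subset_span ⟨x, y, rfl⟩

/-- By Lie's theorem some weight space `W` is nonzero, and its weight vanishes on commutators
because scalars commute. So `z` kills `W`, and induction on the dimension handles `M ⧸ W`. -/
theorem isNilpotent_toEnd_of_mem_commutatorSpan_of_isAlgClosed {K L : Type*} [Field K] [CharZero K]
    [IsAlgClosed K] [LieRing L] [LieAlgebra K L] [LieAlgebra.IsSolvable L] {z : L}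
    (hz : z ∈ commutatorSpan K L) (n : ℕ) :
    ∀ (M : Type _) [AddCommGroup M] [Module K M] [LieRingModule L M] [LieModule K L M]
      [FiniteDimensional K M], Module.finrank K M = n → IsNilpotent (LieModule.toEnd K L M z) := by
  induction n using Nat.strong_induction_on with
  | _ n ih =>
  intro M _ _ _ _ _ hn
  rcases subsingleton_or_nontrivial M with h | h
  · exact ⟨1, LinearMap.ext fun m => Subsingleton.elim _ _⟩
  · obtain ⟨χ, hχ⟩ := LieModule.exists_nontrivial_weightSpace_of_isSolvable K L M
    set W := LieModule.weightSpace M χ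
    have hzero : χ z = 0 := by
      obtain ⟨⟨v, hv⟩, hv0⟩ := exists_ne (0 : W)
      have hv0' : v ≠ 0 := fun h => hv0 (Subtype.ext h)
      have hv' := (LieModule.mem_weightSpace χ v).1 hv
      clear ih
      induction hz using Submodule.span_induction with
      | mem z h =>
        obtain ⟨x, y, rfl⟩ := h
        have h1 := hv' ⁅x, y⁆
        rw [lie_lie, hv', hv', lie_smul, lie_smul, hv', hv', smul_smul, smul_smul, mul_comm,
          sub_self] at h1
        exact (smul_eq_zero.1 h1.symm).resolve_right hv0'
      | zero => simp
      | add x y _ _ hx hy => rw [map_add, hx, hy, add_zero]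
      | smul a x _ hx => rw [map_smul, hx, smul_zero]
    have hlt : Module.finrank K (M ⧸ W) < n := by
      have h1 := Submodule.finrank_quotient_add_finrank (W : Submodule K M)
      have h2 : 0 < Module.finrank K W := Module.finrank_pos
      rw [← hn]
      change Module.finrank K (M ⧸ (W : Submodule K M)) < _
      change 0 < Module.finrank K (W : Submodule K M) at h2
      omega
    obtain ⟨k, hk⟩ := ih _ hlt (M ⧸ W) rfl
    refine ⟨k + 1, LinearMap.ext fun m => ?_⟩
    have hpow : ∀ j : ℕ, ∀ m : M, LieSubmodule.Quotient.mk (N := W)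
        ((LieModule.toEnd K L M z ^ j) m)
          = (LieModule.toEnd K L (M ⧸ W) z ^ j) (LieSubmodule.Quotient.mk m) := by
      intro j
      induction j with
      | zero => intro m; rfl
      | succ j ihj =>
        intro m
        rw [pow_succ, pow_succ, Module.End.mul_apply, Module.End.mul_apply, ihj]
        rfl
    have hmem : (LieModule.toEnd K L M z ^ k) m ∈ W := by
      rw [← LieSubmodule.Quotient.mk_eq_zero', hpow, hk]
      rfl
    rw [pow_succ', Module.End.mul_apply, LieModule.toEnd_apply_apply,
      (LieModule.mem_weightSpace χ _).1 hmem z, hzero, zero_smul]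
    rfl

/-- In a solvable real Lie algebra, every element of the derived algebra is ad-nilpotent. -/
theorem isNilpotent_ad_of_mem_commutatorSpan {L : Type*} [LieRing L] [LieAlgebra ℝ L]
    [FiniteDimensional ℝ L] [LieAlgebra.IsSolvable L] {z : L} (hz : z ∈ commutatorSpan ℝ L) :
    IsNilpotent (LieAlgebra.ad ℝ L z) := by
  -- Lie's theorem needs an algebraically closed field: pass to the complexification and read
  -- nilpotency back on the vectors `1 ⊗ m`.
  open scoped TensorProduct in
  have hz' : (1 : ℂ) ⊗ₜ[ℝ] z ∈ commutatorSpan ℂ (ℂ ⊗[ℝ] L) := by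
    induction hz using Submodule.span_induction with
    | mem z h =>
      obtain ⟨x, y, rfl⟩ := h
      have := lie_mem_commutatorSpan ℂ ((1 : ℂ) ⊗ₜ[ℝ] x) ((1 : ℂ) ⊗ₜ[ℝ] y)
      rwa [LieAlgebra.ExtendScalars.bracket_tmul, mul_one] at this
    | zero => rw [TensorProduct.tmul_zero]; exact zero_mem _
    | add x y _ _ hx hy => rw [TensorProduct.tmul_add]; exact add_mem hx hy
    | smul a x _ hx =>
      rw [TensorProduct.tmul_smul, ← algebraMap_smul ℂ a ((1 : ℂ) ⊗ₜ[ℝ] x)]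
      exact Submodule.smul_mem _ _ hx
  obtain ⟨k, hk⟩ := isNilpotent_toEnd_of_mem_commutatorSpan_of_isAlgClosed hz' _
    (TensorProduct ℝ ℂ L) rfl
  refine ⟨k, LinearMap.ext fun m => ?_⟩
  rw [LieModule.toEnd_baseChange, ← LinearMap.baseChange_pow] at hk
  have h1 := LinearMap.congr_fun hk ((1 : ℂ) ⊗ₜ[ℝ] m)
  rw [LinearMap.baseChange_tmul, LinearMap.zero_apply] at h1
  have h2 : (LieModule.toEnd ℝ L L z ^ k) m = 0 := by simpa using h1
  exact h2

theorem trace_comp_self_eq_zero_of_isNilpotent {V : Type*} [AddCommGroup V] [Module ℝ V]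
    {f : Module.End ℝ V} (hf : IsNilpotent f) : LinearMap.trace ℝ V (f ∘ₗ f) = 0 :=
  (LinearMap.isNilpotent_trace_of_isNilpotent ((Commute.refl f).isNilpotent_mul_left hf)).eq_zero

/-! ### Orthonormal bases of inner products -/

section Orthonormal

open Module

variable {V : Type*} [AddCommGroup V] [Module ℝ V] {ι : Type*} [DecidableEq ι]

/-- A basis is orthonormal for the bilinear form `B`. -/
def IsOrthonormalBasis (B : LinearMap.BilinForm ℝ V) (e : Basis ι ℝ V) : Prop :=
  ∀ i j, B (e i) (e j) = if i = j then 1 else 0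

namespace IsOrthonormalBasis

variable [Fintype ι] {B : LinearMap.BilinForm ℝ V} {e : Basis ι ℝ V}

theorem repr_apply (he : IsOrthonormalBasis B e) (x : V) (i : ι) : e.repr x i = B x (e i) := by
  conv_rhs => rw [← e.sum_repr x]
  simp only [map_sum, LinearMap.sum_apply, map_smul, LinearMap.smul_apply, smul_eq_mul, he _ i]
  simp

theorem sum_smul (he : IsOrthonormalBasis B e) (x : V) : ∑ i, B x (e i) • e i = x := by
  simp_rw [← he.repr_apply]
  exact e.sum_repr x

theorem sum_mul (he : IsOrthonormalBasis B e) (x y : V) :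
    ∑ i, B x (e i) * B y (e i) = B x y := by
  conv_rhs => rw [← he.sum_smul y]
  simp [mul_comm]

theorem trace_eq (he : IsOrthonormalBasis B e) (f : V →ₗ[ℝ] V) :
    LinearMap.trace ℝ V f = ∑ i, B (f (e i)) (e i) := by
  rw [LinearMap.trace_eq_matrix_trace ℝ e, Matrix.trace]
  simp [LinearMap.toMatrix_apply, he.repr_apply]

/-- The vectors `J (e i)` are again orthonormal, and the metric trace of a bilinear form does not
depend on the orthonormal basis. -/
theorem sum_comp_isometry (he : IsOrthonormalBasis B e) {J : V →ₗ[ℝ] V}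
    (hJ : ∀ x y, B (J x) (J y) = B x y) (f : V →ₗ[ℝ] V →ₗ[ℝ] ℝ) (hsurj : Function.Surjective J) :
    ∑ i, f (J (e i)) (J (e i)) = ∑ i, f (e i) (e i) := by
  have hexp (x : V) : f x x = ∑ k, ∑ l, B x (e k) * B x (e l) * f (e k) (e l) := by
    conv_lhs => rw [← he.sum_smul x]
    simp only [map_sum, LinearMap.sum_apply, map_smul, LinearMap.smul_apply, smul_eq_mul]
    simp only [Finset.mul_sum]
    rw [Finset.sum_comm]
    exact Finset.sum_congr rfl fun k _ => Finset.sum_congr rfl fun l _ => by ring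
  -- Parseval for the rotated basis: write `e k` and `e l` as images under `J`.
  have hpars (k l : ι) : ∑ i, B (J (e i)) (e k) * B (J (e i)) (e l) = B (e k) (e l) := by
    obtain ⟨u, hu⟩ := hsurj (e k)
    obtain ⟨v, hv⟩ := hsurj (e l)
    have hsymm : ∀ x y, B x y = B y x := fun x y => by
      rw [← he.sum_mul x y, ← he.sum_mul y x]
      exact Finset.sum_congr rfl fun i _ => mul_comm _ _
    rw [← hu, ← hv]
    simp_rw [hJ, hsymm (e _)]
    exact he.sum_mul u v
  calc ∑ i, f (J (e i)) (J (e i))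
      = ∑ i, ∑ k, ∑ l, B (J (e i)) (e k) * B (J (e i)) (e l) * f (e k) (e l) :=
        Finset.sum_congr rfl fun i _ => hexp _
    _ = ∑ k, ∑ l, (∑ i, B (J (e i)) (e k) * B (J (e i)) (e l)) * f (e k) (e l) := by
        rw [Finset.sum_comm]
        refine Finset.sum_congr rfl fun k _ => ?_
        rw [Finset.sum_comm]
        exact Finset.sum_congr rfl fun l _ => by rw [Finset.sum_mul]
    _ = ∑ i, f (e i) (e i) := by
        simp [hpars, he _ _]

end IsOrthonormalBasis

variable [FiniteDimensional ℝ V]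

theorem exists_isOrthonormalBasis {B : LinearMap.BilinForm ℝ V}
    (hsymm : ∀ x y, B x y = B y x) (hpos : ∀ x, x ≠ 0 → 0 < B x x) :
    ∃ e : Basis (Fin (finrank ℝ V)) ℝ V, IsOrthonormalBasis B e := by
  obtain ⟨v, hv⟩ := LinearMap.BilinForm.exists_orthogonal_basis (B := B) ⟨fun x y => hsymm x y⟩
  replace hpos (i) : 0 < B (v i) (v i) := hpos _ (v.ne_zero i)
  refine ⟨v.isUnitSMul (w := fun i => (√(B (v i) (v i)))⁻¹)
    fun i => (inv_ne_zero (Real.sqrt_pos.2 (hpos i)).ne').isUnit, fun i j => ?_⟩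
  simp only [Basis.isUnitSMul_apply, map_smul, LinearMap.smul_apply, smul_eq_mul]
  split_ifs with h
  · subst h
    have := Real.mul_self_sqrt (hpos i).le
    have := (Real.sqrt_pos.2 (hpos i)).ne'
    field_simp
    nlinarith
  · have h0 : B (v i) (v j) = 0 := hv h
    rw [h0, mul_zero, mul_zero]

/-- Applied with `W` the derived algebra, to split the structure constants into blocks. -/
theorem exists_isOrthonormalBasis_sum {B : LinearMap.BilinForm ℝ V}
    (hsymm : ∀ x y, B x y = B y x) (hpos : ∀ x, x ≠ 0 → 0 < B x x) (W : Submodule ℝ V) :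
    ∃ (m n : ℕ) (e : Basis (Fin m ⊕ Fin n) ℝ V), IsOrthonormalBasis B e ∧
      (∀ i, e (.inl i) ∈ W) ∧ ∀ x ∈ W, ∀ j, B x (e (.inr j)) = 0 := by
  have hrefl : B.IsRefl := fun x y h => by rw [hsymm, h]
  have hp (U : Submodule ℝ V) (x : U) (hx : x ≠ 0) : 0 < B.restrict U x x :=
    hpos x fun h => hx (Subtype.ext h)
  have hnd : (B.restrict W).Nondegenerate := by
    refine ⟨fun x hx => ?_, fun x hx => ?_⟩ <;>
    · by_contra h
      exact (hp W x h).ne' (hx x)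
  have hc := LinearMap.BilinForm.isCompl_orthogonal_of_restrict_nondegenerate hrefl hnd
  obtain ⟨e₁, h₁⟩ := exists_isOrthonormalBasis (B := B.restrict W) (fun x y => hsymm x y) (hp W)
  obtain ⟨e₂, h₂⟩ := exists_isOrthonormalBasis (B := B.restrict (B.orthogonal W))
    (fun x y => hsymm x y) (hp (B.orthogonal W))
  have hl (i) : ((e₁.prod e₂).map (Submodule.prodEquivOfIsCompl _ _ hc)) (.inl i) = e₁ i := by
    simp
  have hr (i) : ((e₁.prod e₂).map (Submodule.prodEquivOfIsCompl _ _ hc)) (.inr i) = e₂ i := by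
    simp
  refine ⟨_, _, (e₁.prod e₂).map (Submodule.prodEquivOfIsCompl _ _ hc), ?_, fun i => ?_,
    fun x hx j => ?_⟩
  · have hort (i) (j) : B (e₁ i) (e₂ j) = 0 := (e₂ j).2 _ (e₁ i).2
    rintro (i | i) (j | j)
    · rw [hl, hl]; simpa using h₁ i j
    · rw [hl, hr]; simpa using hort i j
    · rw [hl, hr, hsymm]; simpa using hort j i
    · rw [hr, hr]; simpa using h₂ i j
  · rw [hl]; exact (e₁ i).2
  · rw [hr]; exact (e₂ j).2 x hx

end Orthonormal

/-- For `G i j k` skew in the last two indices (connection coefficients) and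
`c i j k = G i j k - G j i k` (structure constants), the Killing trace plus half of the squared
norm of `c` is a quadratic expression in `G`. -/
theorem sum_structureConstants {ι : Type*} [Fintype ι] (G : ι → ι → ι → ℝ)
    (hG : ∀ i j k, G i j k = -G i k j) :
    ∑ i, ∑ j, ∑ k, ((G i j k - G j i k) * (G i k j - G k i j) + (G i j k - G j i k) ^ 2 / 2)
      = 2 * ∑ i, ∑ j, ∑ k, G j i k * G k i j := by
  have h1 : ∑ i, ∑ j, ∑ k, G i j k * G k i j = -∑ i, ∑ j, ∑ k, G j i k * G k i j := by
    rw [Finset.sum_comm]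
    simp only [← Finset.sum_neg_distrib]
    refine Finset.sum_congr rfl fun i _ => Finset.sum_congr rfl fun j _ =>
      Finset.sum_congr rfl fun k _ => ?_
    rw [hG k j i]; ring
  have h2 : ∑ i, ∑ j, ∑ k, G i j k * G j i k = ∑ i, ∑ j, ∑ k, G j i k * G k i j := by
    conv_rhs => rw [Finset.sum_comm]; enter [2, i]; rw [Finset.sum_comm]
    refine Finset.sum_congr rfl fun i _ => Finset.sum_congr rfl fun j _ =>
      Finset.sum_congr rfl fun k _ => ?_
    rw [hG i k j, hG j k i]; ring
  have h3 : ∑ i, ∑ j, ∑ k, G j i k ^ 2 = ∑ i, ∑ j, ∑ k, G i j k ^ 2 := Finset.sum_comm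
  have h4 (i j k : ι) :
      (G i j k - G j i k) * (G i k j - G k i j) + (G i j k - G j i k) ^ 2 / 2 =
        -(1 / 2) * G i j k ^ 2 + (1 / 2) * G j i k ^ 2 - G i j k * G k i j
          + G j i k * G k i j := by
    rw [hG i k j]; ring
  simp only [h4, Finset.sum_add_distrib, Finset.sum_sub_distrib, ← Finset.mul_sum, h1, h3]
  ring

/-! ### Unimodular Kähler Lie algebras -/

section Kaehler

open Module LieStr

variable {k : Type*} [LieRing k] [LieAlgebra ℝ k]

/-- A Kähler structure on a Lie algebra: a Hermitian structure with closed fundamental form. -/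
structure IsKaehlerStructure (J : k →ₗ[ℝ] k) (B : LinearMap.BilinForm ℝ k) : Prop where
  hermitian : IsHermitianStructure J B
  closed : ∀ x y z, dTwo (fundamentalForm B J) x y z = 0

variable {J : k →ₗ[ℝ] k} {B : LinearMap.BilinForm ℝ k}

theorem LieStr.IsHermitianStructure.apply_left (h : IsHermitianStructure J B) (x y : k) :
    B (J x) y = -B x (J y) := by
  have h1 := h.compatible x (J y)
  rw [h.complex.sq, map_neg] at h1
  linarith

theorem LieStr.IsHermitianStructure.surjective (h : IsHermitianStructure J B) :
    Function.Surjective J :=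
  fun y => ⟨-J y, by rw [map_neg, h.complex.sq, neg_neg]⟩

variable [FiniteDimensional ℝ k]

/-- The Levi-Civita connection of a Kähler structure commutes with `J`. -/
theorem IsKaehlerStructure.leviCivita_apply (h : IsKaehlerStructure J B) (x y : k) :
    leviCivita B h.hermitian.inner x (J y) = J (leviCivita B h.hermitian.inner x y) := by
  obtain ⟨hh, hc⟩ := h
  rw [← sub_eq_zero]
  refine hh.inner.nondegenerate.1 _ fun z => ?_
  rw [map_sub, LinearMap.sub_apply, hh.apply_left, leviCivita_koszul, leviCivita_koszul]
  -- The Koszul formula turns `B ((∇_x J) y) z` into a linear combination of `dω(x, y, z)`, `dω(x, J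
  -- y, J z)` and the Nijenhuis tensor of `(y, z)` paired with `J x`.
  have c1 := hc x y z
  have c2 := hc x (J y) (J z)
  have n := congrArg (fun w => B w (J x)) (hh.complex.integrable y z)
  simp only [dTwo, fundamentalForm, hh.apply_left, map_add, map_sub, LinearMap.sub_apply,
    LinearMap.add_apply, hh.complex.sq, map_neg, map_zero, LinearMap.zero_apply] at c1 c2 n
  linarith

variable {ι : Type*} [Fintype ι] [DecidableEq ι] {e : Basis ι ℝ k}

/-- On a unimodular Lie algebra with closed fundamental form, the sum of the brackets
`[eᵢ, J eᵢ]` over an orthonormal basis vanishes. -/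
theorem IsKaehlerStructure.sum_lie_eq_zero (h : IsKaehlerStructure J B)
    (hu : IsUnimodular k) (he : IsOrthonormalBasis B e) : ∑ i, ⁅e i, J (e i)⁆ = 0 := by
  obtain ⟨hh, hc⟩ := h
  have h2 (z : k) : B (J (∑ i, ⁅e i, J (e i)⁆)) z = 0 := by
    have h3 := hu z
    have h4 : LinearMap.trace ℝ k (J ∘ₗ LieAlgebra.ad ℝ k z ∘ₗ J) = 0 := by
      rw [LinearMap.trace_comp_comm', LinearMap.comp_assoc]
      have : J ∘ₗ J = -LinearMap.id := LinearMap.ext hh.complex.sq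
      rw [this, LinearMap.comp_neg, LinearMap.comp_id, map_neg, h3, neg_zero]
    rw [he.trace_eq] at h3 h4
    -- Closedness at `(e i, J (e i), z)`; summed over `i`, the right side is a difference of two
    -- vanishing traces.
    have h5 (i) : B (J ⁅e i, J (e i)⁆) z =
        B ((J ∘ₗ LieAlgebra.ad ℝ k z ∘ₗ J) (e i)) (e i) - B (LieAlgebra.ad ℝ k z (e i)) (e i) := by
      have h6 := hc (e i) (J (e i)) z
      simp only [dTwo, fundamentalForm] at h6
      rw [hh.compatible ⁅z, e i⁆, ← lie_skew (J (e i))] at h6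
      simp only [map_neg, LinearMap.neg_apply] at h6
      simp only [LinearMap.comp_apply, LieAlgebra.ad_apply]
      linarith
    simp only [map_sum, LinearMap.sum_apply, h5, Finset.sum_sub_distrib, h3, h4, sub_zero]
  have h7 := hh.inner.nondegenerate.1 _ h2
  have h8 := hh.complex.sq (∑ i, ⁅e i, J (e i)⁆)
  rw [h7, map_zero] at h8
  exact neg_eq_zero.1 h8.symm

/-- For the right multiplications `R z : y ↦ ∇_y z` of the Levi-Civita connection of a unimodular
Kähler Lie algebra, the sum of the traces of `(R eᵢ)²` over an orthonormal basis vanishes. -/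
theorem IsKaehlerStructure.sum_trace_eq_zero (h : IsKaehlerStructure J B)
    (hu : IsUnimodular k) (he : IsOrthonormalBasis B e) :
    ∑ i, LinearMap.trace ℝ k ((leviCivita B h.hermitian.inner).flip (e i) ∘ₗ
      (leviCivita B h.hermitian.inner).flip (e i)) = 0 := by
  set N := leviCivita B h.hermitian.inner with hN
  have hNJ (x : k) : (N x) * J = J * (N x) := LinearMap.ext fun y => h.leviCivita_apply x y
  have hRJ (x : k) : N.flip (J x) = J * N.flip x := LinearMap.ext fun y => h.leviCivita_apply y x
  have hJJ : J * J = -1 := LinearMap.ext h.hermitian.complex.sq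
  have had (x : k) : LieAlgebra.ad ℝ k x = N x - N.flip x := LinearMap.ext fun y =>
    (leviCivita_torsion B h.hermitian.inner x y).symm
  -- Expand `ad = N - R`, with `R` the right multiplication. The operators `N x`, `N (J x)` commute
  -- with `J`, so by cyclicity every term containing them cancels in the trace.
  have key (x : k) : LinearMap.trace ℝ k (J * LieAlgebra.ad ℝ k ⁅x, J x⁆) =
      LinearMap.trace ℝ k (N.flip x * N.flip x) +
        LinearMap.trace ℝ k (N.flip (J x) * N.flip (J x)) := by
    have hlie : LieAlgebra.ad ℝ k ⁅x, J x⁆ = LieAlgebra.ad ℝ k x * LieAlgebra.ad ℝ k (J x) -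
        LieAlgebra.ad ℝ k (J x) * LieAlgebra.ad ℝ k x := LinearMap.ext fun y => lie_lie _ _ _
    rw [hlie, had, had, hRJ]
    set A := N x
    set A' := N (J x)
    set R := N.flip x
    have e1 : J * ((A - R) * (A' - J * R) - (A' - J * R) * (A - R)) =
        (J * A * A' - J * (A' * A)) - (J * A * (J * R)) - (J * R * A' - J * (A' * R))
          + (J * R * (J * R)) + (J * J) * R * A - (J * J) * R * R := by noncomm_ring
    have e2 : J * A * (J * R) = - (A * R) := by
      rw [← hNJ x, mul_assoc, ← mul_assoc J, hJJ, neg_one_mul, mul_neg]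
    have t1 : LinearMap.trace ℝ k (J * A * A') = LinearMap.trace ℝ k (J * (A' * A)) := by
      rw [LinearMap.trace_mul_comm, ← mul_assoc, hNJ (J x), mul_assoc]
    have t2 : LinearMap.trace ℝ k (J * R * A') = LinearMap.trace ℝ k (J * (A' * R)) := by
      rw [LinearMap.trace_mul_comm, ← mul_assoc, hNJ (J x), mul_assoc]
    have t3 := LinearMap.trace_mul_comm ℝ A R
    rw [e1, e2, hJJ]
    simp only [map_add, map_sub, map_neg, t1, t2, neg_mul, one_mul, t3]
    ring
  let F : k →ₗ[ℝ] k →ₗ[ℝ] ℝ :=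
    LinearMap.mk₂ ℝ (fun x y => LinearMap.trace ℝ k (N.flip x * N.flip y))
      (by intros; simp [add_mul]) (by intros; simp) (by intros; simp [mul_add])
      (by intros; simp)
  have h1 : ∑ i, (F (e i) (e i) + F (J (e i)) (J (e i))) = 0 := by
    have h2 : ∑ i, LinearMap.trace ℝ k (J * LieAlgebra.ad ℝ k ⁅e i, J (e i)⁆) = 0 := by
      rw [← map_sum, ← Finset.mul_sum, ← map_sum, h.sum_lie_eq_zero hu he, map_zero, mul_zero,
        map_zero]
    rw [← h2]
    exact Finset.sum_congr rfl fun i _ => (key (e i)).symm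
  rw [Finset.sum_add_distrib,
    he.sum_comp_isometry h.hermitian.compatible F h.hermitian.surjective] at h1
  change ∑ i, F (e i) (e i) = 0
  linarith

/-- The Killing trace plus half of the squared norm of the bracket vanishes on a unimodular Kähler
Lie algebra. -/
theorem IsKaehlerStructure.sum_structureConstants_eq_zero (h : IsKaehlerStructure J B)
    (hu : IsUnimodular k) (he : IsOrthonormalBasis B e) :
    ∑ i, ∑ j, ∑ l, (B ⁅e i, e j⁆ (e l) * B ⁅e i, e l⁆ (e j) + B ⁅e i, e j⁆ (e l) ^ 2 / 2) = 0 := by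
  have h0 := h.sum_trace_eq_zero hu he
  set N := leviCivita B h.hermitian.inner with hN
  have h1 := sum_structureConstants (fun i j l => B (N (e i) (e j)) (e l)) fun i j l => by
    have := leviCivita_metric B h.hermitian.inner (e i) (e j) (e l)
    rw [h.hermitian.inner.symm (e j)] at this
    linarith
  have h2 (i j : ι) : N (e i) (e j) - N (e j) (e i) = ⁅e i, e j⁆ :=
    leviCivita_torsion B h.hermitian.inner _ _
  simp only [← LinearMap.sub_apply, ← map_sub, h2] at h1
  rw [h1, mul_eq_zero_of_right]
  rw [← h0]
  refine Finset.sum_congr rfl fun i _ => ?_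
  rw [he.trace_eq]
  refine Finset.sum_congr rfl fun j _ => ?_
  simp only [LinearMap.comp_apply, LinearMap.flip_apply]
  conv_rhs => rw [← he.sum_smul (N (e j) (e i))]
  simp

end Kaehler

/-! ### Flatness of unimodular Kähler Lie algebras -/

theorem eq_zero_of_sum_sum_sum_sq_eq_zero {α β γ : Type*} [Fintype α] [Fintype β] [Fintype γ]
    {f : α → β → γ → ℝ} (h : ∑ i, ∑ j, ∑ l, f i j l ^ 2 = 0) (i : α) (j : β) (l : γ) :
    f i j l = 0 := by
  rw [Finset.sum_eq_zero_iff_of_nonneg fun _ _ => by positivity] at h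
  have h1 := h i (Finset.mem_univ _)
  rw [Finset.sum_eq_zero_iff_of_nonneg fun _ _ => by positivity] at h1
  have h2 := h1 j (Finset.mem_univ _)
  rw [Finset.sum_eq_zero_iff_of_nonneg fun _ _ => by positivity] at h2
  exact pow_eq_zero_iff two_ne_zero |>.1 (h2 l (Finset.mem_univ _))

/-- Here `inl` indexes the derived algebra and `inr` its complement. By `htr` the Killing terms of
the derived algebra drop out of `hsum`. The two mixed sums of squares agree by skewness and, with
the remaining Killing term, complete the square `Z`; twice `hsum` then reads `X + Y + Z = 0`. -/
theorem structureConstants_of_sum_eq_zero {ι κ : Type*} [Fintype ι] [Fintype κ]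
    (c : ι ⊕ κ → ι ⊕ κ → ι ⊕ κ → ℝ) (hskew : ∀ i j l, c i j l = -c j i l)
    (hinr : ∀ i j l, c i j (.inr l) = 0)
    (htr : ∀ i, ∑ j, ∑ l, c (.inl i) j l * c (.inl i) l j = 0)
    (hsum : ∑ i, ∑ j, ∑ l, (c i j l * c i l j + c i j l ^ 2 / 2) = 0) :
    (∀ i j l, c (.inl i) (.inl j) (.inl l) = 0) ∧ (∀ i j l, c (.inr i) (.inr j) (.inl l) = 0) ∧
      ∀ i j l, c (.inr i) (.inl j) (.inl l) + c (.inr i) (.inl l) (.inl j) = 0 := by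
  set X := ∑ i, ∑ j, ∑ l, c (.inl i) (.inl j) (.inl l) ^ 2 with hX
  set Y := ∑ i, ∑ j, ∑ l, c (.inr i) (.inr j) (.inl l) ^ 2 with hY
  set Z := ∑ i, ∑ j, ∑ l, (c (.inr i) (.inl j) (.inl l) + c (.inr i) (.inl l) (.inl j)) ^ 2 with hZ
  set U := ∑ i, ∑ j, ∑ l, c (.inr i) (.inl j) (.inl l) ^ 2 with hU
  have hU' : ∑ i, ∑ j, ∑ l, c (.inl i) (.inr j) (.inl l) ^ 2 = U := by
    rw [Finset.sum_comm]
    refine Finset.sum_congr rfl fun i _ => Finset.sum_congr rfl fun j _ =>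
      Finset.sum_congr rfl fun l _ => ?_
    rw [hskew, neg_sq]
  have hZ' : Z = 2 * U + 2 * ∑ i, ∑ j, ∑ l,
      c (.inr i) (.inl j) (.inl l) * c (.inr i) (.inl l) (.inl j) := by
    have h1 : ∑ i, ∑ j, ∑ l, c (.inr i) (.inl l) (.inl j) ^ 2 = U :=
      Finset.sum_congr rfl fun i _ => Finset.sum_comm
    simp only [hZ, add_sq, Finset.sum_add_distrib, mul_assoc, ← Finset.mul_sum, h1]
    rw [← hU]
    ring
  have h0 : X + Y + Z = 0 := by
    simp only [Finset.sum_add_distrib, ← Finset.sum_div] at hsum htr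
    rw [Fintype.sum_sum_type] at hsum
    simp only [htr] at hsum
    simp only [Fintype.sum_sum_type, hinr, Finset.sum_add_distrib, Finset.sum_const_zero, zero_pow,
      ne_eq, OfNat.ofNat_ne_zero, not_false_eq_true, mul_zero, zero_mul, add_zero, zero_add,
      hU', ← hX, ← hY, ← hU] at hsum
    linarith
  have hX0 : 0 ≤ X := by positivity
  have hY0 : 0 ≤ Y := by positivity
  have hZ0 : 0 ≤ Z := by positivity
  exact ⟨eq_zero_of_sum_sum_sum_sq_eq_zero (by linarith : X = 0),
    eq_zero_of_sum_sum_sum_sq_eq_zero (by linarith : Y = 0),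
    eq_zero_of_sum_sum_sum_sq_eq_zero (by linarith : Z = 0)⟩

section Flat

open Module LieStr

variable {k : Type*} [LieRing k] [LieAlgebra ℝ k]

/-- A linear map `p` that exhibits the metric `B` as flat with Levi-Civita connection
`∇_x y = ⁅p x, y⁆`, compatibly with `J`. -/
structure IsFlatProjection (J : k →ₗ[ℝ] k) (B : LinearMap.BilinForm ℝ k) (p : k →ₗ[ℝ] k) :
    Prop where
  map_lie : ∀ x y : k, p ⁅x, y⁆ = 0
  lie_eq : ∀ x y, ⁅p x, y⁆ - ⁅p y, x⁆ = ⁅x, y⁆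
  lie_map_map : ∀ x y, ⁅p x, p y⁆ = 0
  skew : ∀ x y z, B ⁅p x, y⁆ z + B y ⁅p x, z⁆ = 0
  comm : ∀ x y, ⁅p x, J y⁆ = J ⁅p x, y⁆
  derivation_comm : ∀ D : k →ₗ[ℝ] k, (∀ x y, D ⁅x, y⁆ = ⁅D x, y⁆ + ⁅x, D y⁆) →
    (∀ x y, B (D x) y + B x (D y) = 0) → ∀ x, D (p x) = p (D x)

variable {J : k →ₗ[ℝ] k} {B : LinearMap.BilinForm ℝ k} [FiniteDimensional ℝ k]

/-- A unimodular Kähler Lie algebra such that `tr ((ad z)²) = 0` for all `z` in the derived algebra is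
flat. -/
theorem IsKaehlerStructure.exists_isFlatProjection (h : IsKaehlerStructure J B)
    (hu : IsUnimodular k)
    (htr : ∀ z ∈ commutatorSpan ℝ k,
      LinearMap.trace ℝ k (LieAlgebra.ad ℝ k z ∘ₗ LieAlgebra.ad ℝ k z) = 0) :
    ∃ p : k →ₗ[ℝ] k, IsFlatProjection J B p := by
  have hB := h.hermitian.inner
  obtain ⟨m, n, e, he, hinl, hinr⟩ :=
    exists_isOrthonormalBasis_sum hB.symm hB.pos (commutatorSpan ℝ k)
  obtain ⟨hX, hY, hZ⟩ := structureConstants_of_sum_eq_zero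
    (fun i j l => B ⁅e i, e j⁆ (e l))
    (fun i j l => by rw [← lie_skew, map_neg, LinearMap.neg_apply])
    (fun i j l => hinr _ (lie_mem_commutatorSpan ℝ _ _) _)
    (fun i => by
      rw [← htr _ (hinl i), he.trace_eq]
      refine Finset.sum_congr rfl fun j _ => ?_
      simp only [LinearMap.comp_apply, LieAlgebra.ad_apply]
      conv_rhs => rw [← he.sum_smul ⁅e (.inl i), e j⁆]
      simp [lie_sum])
    (h.sum_structureConstants_eq_zero hu he)
  have hX' (i j) : ⁅e (.inl i), e (.inl j)⁆ = 0 := by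
    rw [← he.sum_smul ⁅_, _⁆, Fintype.sum_sum_type]
    simp [hX, hinr _ (lie_mem_commutatorSpan ℝ _ _)]
  have hY' (i j) : ⁅e (.inr i), e (.inr j)⁆ = 0 := by
    rw [← he.sum_smul ⁅_, _⁆, Fintype.sum_sum_type]
    simp [hY, hinr _ (lie_mem_commutatorSpan ℝ _ _)]
  have hskew (i) (y z : k) : B ⁅e (.inr i), y⁆ z + B y ⁅e (.inr i), z⁆ = 0 := by
    have h1 : B.comp (LieAlgebra.ad ℝ k (e (.inr i))) LinearMap.id +
        B.comp LinearMap.id (LieAlgebra.ad ℝ k (e (.inr i))) = 0 := by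
      refine e.ext fun a => e.ext fun b => ?_
      simp only [LinearMap.add_apply, LinearMap.BilinForm.comp_apply, LieAlgebra.ad_apply,
        LinearMap.id_apply, LinearMap.zero_apply]
      rw [hB.symm (e a)]
      rcases a with a | a <;> rcases b with b | b
      · exact hZ i a b
      · rw [hY', hinr _ (lie_mem_commutatorSpan ℝ _ _)]; simp
      · rw [hY', hinr _ (lie_mem_commutatorSpan ℝ _ _)]; simp
      · rw [hY', hY']; simp
    exact LinearMap.congr_fun (LinearMap.congr_fun h1 y) z
  -- The orthogonal projection onto the complement of the derived algebra.
  let p : k →ₗ[ℝ] k := ∑ j, (B.flip (e (.inr j))).smulRight (e (.inr j))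
  have hp (x : k) : p x = ∑ j, B x (e (.inr j)) • e (.inr j) := by simp [p]
  have hpW {x : k} (hx : x ∈ commutatorSpan ℝ k) : p x = 0 := by simp [hp, hinr x hx]
  have hdec (x : k) : x - p x = ∑ i, B x (e (.inl i)) • e (.inl i) := by
    rw [sub_eq_iff_eq_add, hp]
    conv_lhs => rw [← he.sum_smul x, Fintype.sum_sum_type]
  have hsubW (x : k) : x - p x ∈ commutatorSpan ℝ k := by
    rw [hdec]
    exact Submodule.sum_mem _ fun i _ => Submodule.smul_mem _ _ (hinl i)
  have hpsymm (x y : k) : B (p x) y = B x (p y) := by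
    simp only [hp, map_sum, LinearMap.sum_apply, map_smul, LinearMap.smul_apply, smul_eq_mul,
      hB.symm y]
    exact Finset.sum_congr rfl fun j _ => mul_comm _ _
  have hab (x y : k) : ⁅x - p x, y - p y⁆ = 0 := by
    simp [hdec, sum_lie, lie_sum, hX']
  have hpp (x y : k) : ⁅p x, p y⁆ = 0 := by
    simp [hp, sum_lie, lie_sum, hY']
  have hlie (x y : k) : ⁅p x, y⁆ - ⁅p y, x⁆ = ⁅x, y⁆ := by
    have h1 := hab x y
    simp only [sub_lie, lie_sub, hpp, sub_zero] at h1
    rw [← lie_skew (p y)]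
    linear_combination (norm := module) -h1
  have hpskew (x y z : k) : B ⁅p x, y⁆ z + B y ⁅p x, z⁆ = 0 := by
    simp only [hp, sum_lie, smul_lie, map_sum, map_smul, LinearMap.sum_apply, LinearMap.smul_apply,
      ← Finset.sum_add_distrib, ← smul_add, hskew, smul_zero, Finset.sum_const_zero]
  have hLC (x y : k) : leviCivita B hB x y = ⁅p x, y⁆ := by
    rw [← sub_eq_zero]
    refine hB.nondegenerate.1 _ fun z => ?_
    rw [map_sub, LinearMap.sub_apply, leviCivita_koszul, ← hlie x y, ← hlie y z, ← hlie z x]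
    simp only [map_sub, LinearMap.sub_apply]
    have hs (a b c : k) : B ⁅p a, b⁆ c + B ⁅p a, c⁆ b = 0 := by
      rw [hB.symm ⁅p a, c⁆]; exact hpskew a b c
    linarith [hs x y z, hs y x z, hs z x y]
  refine ⟨p, fun x y => hpW (lie_mem_commutatorSpan ℝ x y), hlie, hpp, hpskew, fun x y => ?_,
    fun D hD hDB x => ?_⟩
  · rw [← hLC, ← hLC, h.leviCivita_apply]
  -- A derivation preserves the derived algebra; being skew, it also preserves the orthogonal
  -- complement, so it commutes with `p`.
  · have hDW {w : k} (hw : w ∈ commutatorSpan ℝ k) : D w ∈ commutatorSpan ℝ k := by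
      induction hw using Submodule.span_induction with
      | mem z hz =>
        obtain ⟨a, b, rfl⟩ := hz
        rw [hD]
        exact add_mem (lie_mem_commutatorSpan ℝ _ _) (lie_mem_commutatorSpan ℝ _ _)
      | zero => rw [map_zero]; exact zero_mem _
      | add a b _ _ ha hb => rw [map_add]; exact add_mem ha hb
      | smul a b _ hb => rw [map_smul]; exact Submodule.smul_mem _ _ hb
    have hperp (y : k) {w : k} (hw : w ∈ commutatorSpan ℝ k) : B (p y) w = 0 := by
      rw [hpsymm, hpW hw, map_zero]
    rw [← sub_eq_zero]
    refine hB.nondegenerate.1 _ fun y => ?_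
    have h1 := hperp x (hDW (hsubW y))
    have h2 := hperp y (hDW (hsubW x))
    have h3 := hDB (p x) (y - p y)
    rw [hB.symm] at h2
    rw [map_sub D x, map_sub B, LinearMap.sub_apply] at h2
    rw [h1, map_sub] at h3
    rw [map_sub, LinearMap.sub_apply, hpsymm]
    linarith

end Flat

/-! ### Transverse Lie algebras and the complete LSA structure -/

section Transverse

open Module LieStr

variable {g : Type*} [LieRing g] [LieAlgebra ℝ g]

/-- Data exhibiting `g` as `ℝ A ⋉ (central extension by ℝ ξ)`: the closed form `θ` is dual to `A`,
the form `η` is dual to the central element `ξ`. Each of the pairs `(θ, A)` and `(η, ξ)` may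
vanish. -/
structure IsDoubleExtension (A ξ : g) (θ η : Dual ℝ g) : Prop where
  theta_lie : ∀ x y : g, θ ⁅x, y⁆ = 0
  theta_A : θ A = 1 ∨ θ = 0 ∧ A = 0
  eta_xi : η ξ = 1 ∨ η = 0 ∧ ξ = 0
  eta_A : η A = 0
  theta_xi : θ ξ = 0
  central : ∀ x : g, ⁅ξ, x⁆ = 0
  eta_lie_A : ∀ x : g, η ⁅A, x⁆ = 0

/-- The space transverse to `A` and `ξ`. -/
abbrev TransverseSpace (θ η : Dual ℝ g) : Submodule ℝ g := LinearMap.ker θ ⊓ LinearMap.ker η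

namespace IsDoubleExtension

variable {A ξ : g} {θ η : Dual ℝ g}

theorem theta_coe (v : TransverseSpace θ η) : θ v = 0 := v.2.1

theorem eta_coe (v : TransverseSpace θ η) : η v = 0 := v.2.2

theorem theta_mul (h : IsDoubleExtension A ξ θ η) (x : g) : θ x * θ A = θ x := by
  rcases h.theta_A with h | ⟨h, -⟩ <;> simp [h]

theorem eta_mul (h : IsDoubleExtension A ξ θ η) (x : g) : η x * η ξ = η x := by
  rcases h.eta_xi with h | ⟨h, -⟩ <;> simp [h]

theorem lie_xi (h : IsDoubleExtension A ξ θ η) (x : g) : ⁅x, ξ⁆ = 0 := by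
  rw [← lie_skew, h.central, neg_zero]

/-- The projection onto the transverse space. -/
noncomputable def proj (h : IsDoubleExtension A ξ θ η) : g →ₗ[ℝ] TransverseSpace θ η :=
  LinearMap.codRestrict _ (LinearMap.id - θ.smulRight A - η.smulRight ξ) fun x => by
    constructor
    · simp [h.theta_xi, h.theta_mul]
    · simp [h.eta_A, h.eta_mul]

theorem coe_proj (h : IsDoubleExtension A ξ θ η) (x : g) :
    (h.proj x : g) = x - θ x • A - η x • ξ := rfl

theorem proj_coe (h : IsDoubleExtension A ξ θ η) (v : TransverseSpace θ η) : h.proj v = v :=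
  Subtype.ext (by rw [coe_proj, theta_coe, eta_coe]; simp)

theorem proj_xi (h : IsDoubleExtension A ξ θ η) : h.proj ξ = 0 :=
  Subtype.ext (by
    rw [coe_proj, h.theta_xi]
    rcases h.eta_xi with h | ⟨-, h⟩ <;> simp [h])

theorem coe_proj_lie (h : IsDoubleExtension A ξ θ η) (x y : g) :
    (h.proj ⁅x, y⁆ : g) = ⁅x, y⁆ - η ⁅x, y⁆ • ξ := by
  rw [coe_proj, h.theta_lie, zero_smul, sub_zero]

theorem eq_zero_of_proj (h : IsDoubleExtension A ξ θ η) {x : g} (h1 : θ x = 0)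
    (h2 : h.proj x = 0) (h3 : η x = 0) : x = 0 := by
  have := h.coe_proj x
  rw [h1, h2, h3] at this
  simpa using this.symm

theorem lie_coe_proj_lie (h : IsDoubleExtension A ξ θ η) (x y z : g) :
    ⁅x, (h.proj ⁅y, z⁆ : g)⁆ = ⁅x, ⁅y, z⁆⁆ := by
  rw [coe_proj_lie, lie_sub, lie_smul, h.lie_xi, smul_zero, sub_zero]

/-- The Lie ring structure on the transverse space. -/
@[reducible]
noncomputable def lieRing (h : IsDoubleExtension A ξ θ η) : LieRing (TransverseSpace θ η) where
  bracket v w := h.proj ⁅(v : g), (w : g)⁆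
  add_lie := by intros; simp
  lie_add := by intros; simp
  lie_self := by intros; simp
  leibniz_lie u v w := by
    change h.proj ⁅(u : g), (h.proj ⁅(v : g), (w : g)⁆ : g)⁆ =
      h.proj ⁅(h.proj ⁅(u : g), (v : g)⁆ : g), (w : g)⁆ +
        h.proj ⁅(v : g), (h.proj ⁅(u : g), (w : g)⁆ : g)⁆
    rw [← lie_skew (h.proj _ : g) (w : g), h.lie_coe_proj_lie, h.lie_coe_proj_lie,
      h.lie_coe_proj_lie, lie_skew, ← map_add, ← leibniz_lie]

/-- The Lie algebra structure on the transverse space. -/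
@[reducible]
noncomputable def lieAlgebra (h : IsDoubleExtension A ξ θ η) :
    letI := h.lieRing
    LieAlgebra ℝ (TransverseSpace θ η) :=
  letI := h.lieRing
  { lie_smul := fun t v w => by
      change h.proj ⁅(v : g), t • (w : g)⁆ = t • h.proj ⁅(v : g), (w : g)⁆
      rw [lie_smul, map_smul] }

/-- By cyclicity the transverse trace is that of `ad v - θ ⊗ [v, A]` on `g`, and the correction has
trace `θ [v, A] = 0`. -/
theorem trace_ad_eq_zero [FiniteDimensional ℝ g] (h : IsDoubleExtension A ξ θ η)
    (hu : IsUnimodular g) :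
    letI := h.lieRing
    letI := h.lieAlgebra
    IsUnimodular (TransverseSpace θ η) := by
  let := h.lieRing
  let := h.lieAlgebra
  intro v
  have h1 : LieAlgebra.ad ℝ (TransverseSpace θ η) v =
      h.proj ∘ₗ (LieAlgebra.ad ℝ g v ∘ₗ (TransverseSpace θ η).subtype) := rfl
  have h2 : (LieAlgebra.ad ℝ g v ∘ₗ (TransverseSpace θ η).subtype) ∘ₗ h.proj =
      LieAlgebra.ad ℝ g v - θ.smulRight ⁅(v : g), A⁆ := LinearMap.ext fun x => by
    simp [coe_proj, h.lie_xi]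
  rw [h1, LinearMap.trace_comp_comm', h2, map_sub, hu]
  simp [h.theta_lie]

/-- A transverse commutator differs from an element of the derived algebra of `g` by a multiple of
the central `ξ`, which does not change `ad`. The projection intertwines the powers of the two
adjoint operators. -/
theorem isNilpotent_ad [FiniteDimensional ℝ g] [LieAlgebra.IsSolvable g]
    (h : IsDoubleExtension A ξ θ η) :
    letI := h.lieRing
    letI := h.lieAlgebra
    ∀ z ∈ commutatorSpan ℝ (TransverseSpace θ η),
      IsNilpotent (LieAlgebra.ad ℝ (TransverseSpace θ η) z) := by
  let := h.lieRing
  let := h.lieAlgebra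
  intro z hz
  have h1 : ∃ c : ℝ, (z : g) + c • ξ ∈ commutatorSpan ℝ g := by
    induction hz using Submodule.span_induction with
    | mem z hz =>
      obtain ⟨x, y, rfl⟩ := hz
      refine ⟨η ⁅(x : g), (y : g)⁆, ?_⟩
      change (h.proj ⁅(x : g), (y : g)⁆ : g) + _ ∈ _
      rw [coe_proj_lie, sub_add_cancel]
      exact lie_mem_commutatorSpan ℝ _ _
    | zero => exact ⟨0, by simp⟩
    | add x y _ _ hx hy =>
      obtain ⟨a, ha⟩ := hx
      obtain ⟨b, hb⟩ := hy
      refine ⟨a + b, ?_⟩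
      convert add_mem ha hb using 1
      rw [Submodule.coe_add]
      module
    | smul t x _ hx =>
      obtain ⟨a, ha⟩ := hx
      refine ⟨t * a, ?_⟩
      convert Submodule.smul_mem _ t ha using 1
      rw [Submodule.coe_smul]
      module
  obtain ⟨c, hc⟩ := h1
  have h2 : LieAlgebra.ad ℝ g ((z : g) + c • ξ) = LieAlgebra.ad ℝ g z := LinearMap.ext fun x => by
    simp [h.central]
  obtain ⟨n, hn⟩ := isNilpotent_ad_of_mem_commutatorSpan hc
  rw [h2] at hn
  have h3 (j : ℕ) (v : TransverseSpace θ η) : θ ((LieAlgebra.ad ℝ g z ^ j) v) = 0 ∧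
      h.proj ((LieAlgebra.ad ℝ g z ^ j) v) =
        (LieAlgebra.ad ℝ (TransverseSpace θ η) z ^ j) v := by
    induction j with
    | zero => exact ⟨theta_coe v, h.proj_coe v⟩
    | succ j ih =>
      rw [pow_succ', pow_succ', Module.End.mul_apply, Module.End.mul_apply, ← ih.2]
      refine ⟨h.theta_lie _ _, ?_⟩
      change _ = h.proj ⁅(z : g), (h.proj _ : g)⁆
      rw [coe_proj, ih.1, lie_sub, lie_sub, lie_smul, lie_smul, h.lie_xi]
      simp
  refine ⟨n, LinearMap.ext fun v => ?_⟩
  rw [← (h3 n v).2, hn, LinearMap.zero_apply, map_zero, LinearMap.zero_apply]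

end IsDoubleExtension

/-- Transverse Kähler geometry of a double extension. -/
structure IsTransverseKaehler (J : g →ₗ[ℝ] g) (B : LinearMap.BilinForm ℝ g) (A ξ : g)
    (θ η : Dual ℝ g) (c : ℝ) : Prop extends IsDoubleExtension A ξ θ η where
  inner : IsInnerProduct B
  lie_A_skew : ∀ x y, B ⁅A, x⁆ y + B x ⁅A, y⁆ = 0
  map_mem : ∀ v ∈ TransverseSpace θ η, J v ∈ TransverseSpace θ η
  sq : ∀ v ∈ TransverseSpace θ η, J (J v) = -v
  compatible : ∀ v ∈ TransverseSpace θ η, ∀ w ∈ TransverseSpace θ η, B (J v) (J w) = B v w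
  contact : ∀ v ∈ TransverseSpace θ η, ∀ w ∈ TransverseSpace θ η, η ⁅v, w⁆ = c * B (J v) w
  closed : ∀ u ∈ TransverseSpace θ η, ∀ v ∈ TransverseSpace θ η, ∀ w ∈ TransverseSpace θ η,
    B (J (⁅u, v⁆ - η ⁅u, v⁆ • ξ)) w + B (J (⁅v, w⁆ - η ⁅v, w⁆ • ξ)) u +
      B (J (⁅w, u⁆ - η ⁅w, u⁆ • ξ)) v = 0
  integrable : ∀ v ∈ TransverseSpace θ η, ∀ w ∈ TransverseSpace θ η,
    ⁅J v, J w⁆ - η ⁅J v, J w⁆ • ξ - (⁅v, w⁆ - η ⁅v, w⁆ • ξ) =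
      J (⁅J v, w⁆ + ⁅v, J w⁆ - η (⁅J v, w⁆ + ⁅v, J w⁆) • ξ)

/-- The flat connection of the transverse Kähler algebra is a left-symmetric product; it is lifted
through the central extension by `ξ` and the action of `A`. -/
theorem IsTransverseKaehler.exists_isCompleteLSAStructure [FiniteDimensional ℝ g]
    [LieAlgebra.IsSolvable g] {J : g →ₗ[ℝ] g} {B : LinearMap.BilinForm ℝ g} {A ξ : g}
    {θ η : Dual ℝ g} {c : ℝ} (h : IsTransverseKaehler J B A ξ θ η c) (hu : IsUnimodular g) :
    ∃ m : g →ₗ[ℝ] g →ₗ[ℝ] g, IsCompleteLSAStructure m := by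
  have hd := h.toIsDoubleExtension
  let := hd.lieRing
  let := hd.lieAlgebra
  have hbr (v w : TransverseSpace θ η) : ⁅v, w⁆ = hd.proj ⁅(v : g), (w : g)⁆ := rfl
  have hcbr (v w : TransverseSpace θ η) :
      ((⁅v, w⁆ : TransverseSpace θ η) : g) = ⁅(v : g), (w : g)⁆ - η ⁅(v : g), (w : g)⁆ • ξ :=
    hd.coe_proj_lie _ _
  let JV : TransverseSpace θ η →ₗ[ℝ] TransverseSpace θ η := J.restrict h.map_mem
  have hJV (v : TransverseSpace θ η) : (JV v : g) = J v := rfl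
  have hK : IsKaehlerStructure JV (B.restrict (TransverseSpace θ η)) := by
    refine ⟨⟨⟨fun v => Subtype.ext (h.sq v v.2), fun v w => Subtype.ext ?_⟩,
      ⟨fun v w => h.inner.symm v w, fun v hv => h.inner.pos v fun h0 => hv (Subtype.ext h0)⟩,
      fun v w => h.compatible v v.2 w w.2⟩, fun u v w => ?_⟩
    · have := h.integrable v v.2 w w.2
      rw [← sub_eq_zero] at this
      convert this using 1
      simp only [Submodule.coe_sub, Submodule.coe_add, hcbr, hJV, map_add, map_sub, add_smul,
        add_sub_add_comm]
      rfl
    · have := h.closed u u.2 v v.2 w w.2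
      have e1 : B.restrict (TransverseSpace θ η) (JV ⁅u, v⁆) w =
          B (J (⁅(u : g), (v : g)⁆ - η ⁅(u : g), (v : g)⁆ • ξ)) w := by
        rw [← hcbr]; rfl
      have e2 : B.restrict (TransverseSpace θ η) (JV ⁅v, w⁆) u =
          B (J (⁅(v : g), (w : g)⁆ - η ⁅(v : g), (w : g)⁆ • ξ)) u := by
        rw [← hcbr]; rfl
      have e3 : B.restrict (TransverseSpace θ η) (JV ⁅w, u⁆) v =
          B (J (⁅(w : g), (u : g)⁆ - η ⁅(w : g), (u : g)⁆ • ξ)) v := by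
        rw [← hcbr]; rfl
      rw [dTwo, fundamentalForm, fundamentalForm, fundamentalForm, e1, e2, e3]
      linarith
  obtain ⟨p, hp⟩ := hK.exists_isFlatProjection (hd.trace_ad_eq_zero hu) fun z hz =>
    trace_comp_self_eq_zero_of_isNilpotent (hd.isNilpotent_ad z hz)
  let D : TransverseSpace θ η →ₗ[ℝ] TransverseSpace θ η :=
    hd.proj ∘ₗ LieAlgebra.ad ℝ g A ∘ₗ (TransverseSpace θ η).subtype
  have hD (v : TransverseSpace θ η) : D v = hd.proj ⁅A, (v : g)⁆ := rfl
  have hcD (v : TransverseSpace θ η) : (D v : g) = ⁅A, (v : g)⁆ := by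
    rw [hD, hd.coe_proj_lie, hd.eta_lie_A, zero_smul, sub_zero]
  have hDlie (v w : TransverseSpace θ η) : D ⁅v, w⁆ = ⁅D v, w⁆ + ⁅v, D w⁆ := by
    rw [hD, hbr, hd.lie_coe_proj_lie, leibniz_lie, map_add, hbr, hbr, hcD, hcD]
  have hDp (v : TransverseSpace θ η) : D (p v) = p (D v) := by
    refine hp.derivation_comm D hDlie (fun v w => ?_) v
    change B (D v) w + B v (D w) = 0
    rw [hcD, hcD]
    exact h.lie_A_skew _ _
  let σ : TransverseSpace θ η →ₗ[ℝ] TransverseSpace θ η →ₗ[ℝ] ℝ :=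
    LinearMap.mk₂ ℝ (fun v w => η ⁅(v : g), (w : g)⁆)
      (by intros; simp) (by intros; simp) (by intros; simp) (by intros; simp)
  have hσ (v w : TransverseSpace θ η) : σ v w = η ⁅(v : g), (w : g)⁆ := rfl
  have hσD (v w : TransverseSpace θ η) : σ (D v) w + σ v (D w) = 0 := by
    rw [hσ, hσ, hcD, hcD, ← map_add, ← leibniz_lie, hd.eta_lie_A]
  -- `σ` is `c` times the fundamental form, and `ad (p u)` is skew and commutes with `J`.
  have hσp (u v w : TransverseSpace θ η) : σ ⁅p u, v⁆ w + σ v ⁅p u, w⁆ = 0 := by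
    have h1 := hp.skew u (JV v) w
    rw [hp.comm] at h1
    have h2 (v w : TransverseSpace θ η) : σ v w = c * B.restrict (TransverseSpace θ η) (JV v) w :=
      h.contact v v.2 w w.2
    rw [h2, h2, ← mul_add, h1, mul_zero]
  -- `A` acts from the left by `D` and from the right by zero. The factor `1 / 2` makes the
  -- commutator contribute exactly the skew form `σ`.
  let m : g →ₗ[ℝ] g →ₗ[ℝ] g := LinearMap.mk₂ ℝ
    (fun u v => ((θ u • D (hd.proj v) + ⁅p (hd.proj u), hd.proj v⁆ : TransverseSpace θ η) : g) +
        ((1 / 2) * σ (hd.proj u) (hd.proj v)) • ξ)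
    (by
      intro u u' v
      simp only [map_add, add_lie, LinearMap.add_apply, Submodule.coe_add, Submodule.coe_smul]
      module)
    (by
      intro t u v
      simp only [map_smul, smul_lie, LinearMap.smul_apply, smul_eq_mul, Submodule.coe_add,
        Submodule.coe_smul]
      module)
    (by
      intro u v v'
      simp only [map_add, lie_add, Submodule.coe_add, Submodule.coe_smul]
      module)
    (by
      intro t u v
      simp only [map_smul, lie_smul, smul_eq_mul, Submodule.coe_add, Submodule.coe_smul]
      module)
  have hm (u v : g) :
      m u v = ((θ u • D (hd.proj v) + ⁅p (hd.proj u), hd.proj v⁆ : TransverseSpace θ η) : g) +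
        ((1 / 2) * σ (hd.proj u) (hd.proj v)) • ξ := rfl
  have hmθ (u v : g) : θ (m u v) = 0 := by
    rw [hm, map_add, IsDoubleExtension.theta_coe, map_smul, hd.theta_xi, smul_zero, add_zero]
  have hmP (u v : g) : hd.proj (m u v) = θ u • D (hd.proj v) + ⁅p (hd.proj u), hd.proj v⁆ := by
    rw [hm, map_add, hd.proj_coe, map_smul, hd.proj_xi, smul_zero, add_zero]
  have hmη (u v : g) : η (m u v) = (1 / 2) * σ (hd.proj u) (hd.proj v) := by
    have h1 := hd.eta_mul ⁅(hd.proj u : g), (hd.proj v : g)⁆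
    rw [hm, map_add, IsDoubleExtension.eta_coe, map_smul, smul_eq_mul, zero_add, mul_assoc, hσ, h1]
  have hext {x y : g} (h1 : θ x = θ y) (h2 : hd.proj x = hd.proj y) (h3 : η x = η y) : x = y := by
    rw [← sub_eq_zero]
    exact hd.eq_zero_of_proj (by rw [map_sub, h1, sub_self]) (by rw [map_sub, h2, sub_self])
      (by rw [map_sub, h3, sub_self])
  have hlie (u v : g) : ⁅u, v⁆ = ⁅(hd.proj u : g), (hd.proj v : g)⁆ +
      θ u • ⁅A, (hd.proj v : g)⁆ - θ v • ⁅A, (hd.proj u : g)⁆ := by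
    have e1 : u = hd.proj u + θ u • A + η u • ξ := by rw [hd.coe_proj]; module
    have e2 : v = hd.proj v + θ v • A + η v • ξ := by rw [hd.coe_proj]; module
    conv_lhs => rw [e1, e2]
    simp only [lie_add, add_lie, smul_lie, lie_smul, hd.central, hd.lie_xi, lie_self]
    rw [← lie_skew A (hd.proj u : g)]
    module
  have hσskew (v w : TransverseSpace θ η) : σ v w = -σ w v := by rw [hσ, hσ, ← lie_skew, map_neg]
  refine ⟨m, ⟨fun u v => hext ?_ ?_ ?_, fun u v w => hext ?_ ?_ ?_⟩, fun x => ?_⟩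
  · rw [map_sub, hmθ, hmθ, hd.theta_lie, sub_zero]
  · rw [map_sub, hmP, hmP, hlie, map_sub, map_add, map_smul, map_smul, ← hD, ← hD, ← hbr,
      ← hp.lie_eq]
    module
  · rw [map_sub, hmη, hmη, hlie, map_sub, map_add, map_smul, map_smul, hd.eta_lie_A, hd.eta_lie_A,
      ← hσ, hσskew (hd.proj v)]
    simp only [smul_zero]
    ring
  · simp only [map_sub, hmθ]
  · simp only [map_sub, hmP, hmθ, zero_smul, zero_add, map_add, map_smul, hDlie, hDp, lie_add,
      smul_lie, lie_smul, hp.map_lie, add_zero]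
    have h1 : ⁅p (hd.proj u), ⁅p (hd.proj v), hd.proj w⁆⁆ =
        ⁅p (hd.proj v), ⁅p (hd.proj u), hd.proj w⁆⁆ := by
      rw [leibniz_lie, hp.lie_map_map, zero_lie, zero_add]
    rw [h1]
    module
  · simp only [map_sub, hmη, hmP, map_add, map_smul, LinearMap.add_apply, LinearMap.smul_apply,
      smul_eq_mul]
    have h1 := hσD (hd.proj u) (hd.proj w)
    have h2 := hσD (hd.proj v) (hd.proj w)
    have h3 := hσp (hd.proj u) (hd.proj v) (hd.proj w)
    have h4 := hσp (hd.proj v) (hd.proj u) (hd.proj w)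
    linear_combination (1 / 2) * θ v * h1 - (1 / 2) * θ u * h2 - (1 / 2) * h3 + (1 / 2) * h4
  -- The kernel is eliminated one component at a time: `θ y`, then `p` of the transverse part (`p`
  -- kills brackets), then the transverse part itself, then `η y`.
  · have hinj : Function.Injective (LinearMap.id + m.flip x : g →ₗ[ℝ] g) := by
      rw [← LinearMap.ker_eq_bot, LinearMap.ker_eq_bot']
      intro y hy
      replace hy : y + m y x = 0 := hy
      have h1 : θ y = 0 := by
        have := congrArg θ hy
        rwa [map_add, hmθ, add_zero, map_zero] at this
      have h2 : hd.proj y + ⁅p (hd.proj y), hd.proj x⁆ = 0 := by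
        have := congrArg hd.proj hy
        rwa [map_add, hmP, h1, zero_smul, zero_add, map_zero] at this
      have h3 : p (hd.proj y) = 0 := by
        have := congrArg p h2
        rwa [map_add, hp.map_lie, add_zero, map_zero] at this
      rw [h3, zero_lie, add_zero] at h2
      have h4 : η y = 0 := by
        have := congrArg η hy
        rwa [map_add, hmη, h2, map_zero, LinearMap.zero_apply, mul_zero, add_zero, map_zero] at this
      exact hd.eq_zero_of_proj h1 h2 h4
    exact ⟨hinj, LinearMap.injective_iff_surjective.1 hinj⟩

end Transverse

/-! ### Sasakian and Vaisman Lie algebras -/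

section Structures

open Module LieStr

/-- For skew `f` the trace of `f²` is minus the sum of the squared norms of `f (e i)`, while
nilpotency makes it zero. -/
theorem eq_zero_of_skew_of_isNilpotent {V : Type*} [AddCommGroup V] [Module ℝ V]
    [FiniteDimensional ℝ V] {B : LinearMap.BilinForm ℝ V} (hsymm : ∀ x y, B x y = B y x)
    (hpos : ∀ x, x ≠ 0 → 0 < B x x) {f : Module.End ℝ V} (hf : IsNilpotent f)
    (hskew : ∀ x y, B (f x) y + B x (f y) = 0) : f = 0 := by
  obtain ⟨e, he⟩ := exists_isOrthonormalBasis hsymm hpos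
  have h1 := trace_comp_self_eq_zero_of_isNilpotent hf
  have h2 (i) : B ((f ∘ₗ f) (e i)) (e i) = -B (f (e i)) (f (e i)) :=
    eq_neg_of_add_eq_zero_left (hskew (f (e i)) (e i))
  have hnn (x : V) : 0 ≤ B x x := by
    rcases eq_or_ne x 0 with rfl | h
    · simp
    · exact (hpos x h).le
  rw [he.trace_eq] at h1
  simp only [h2, Finset.sum_neg_distrib, neg_eq_zero] at h1
  rw [Finset.sum_eq_zero_iff_of_nonneg fun i _ => hnn _] at h1
  refine e.ext fun i => ?_
  by_contra h
  exact (hpos _ h).ne' (h1 i (Finset.mem_univ _))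

variable {g : Type*} [LieRing g] [LieAlgebra ℝ g]

theorem LieStr.IsInnerProduct.nonneg {B : LinearMap.BilinForm ℝ g} (hB : IsInnerProduct B)
    (x : g) : 0 ≤ B x x := by
  rcases eq_or_ne x 0 with rfl | h
  · simp
  · exact (hB.pos x h).le

namespace LieStr.IsSasakianStructure

variable {B : LinearMap.BilinForm ℝ g} {φ : g →ₗ[ℝ] g} {ξ : g} {η : Dual ℝ g}

theorem eta_lie (h : IsSasakianStructure B φ ξ η) (x y : g) : η ⁅x, y⁆ = B (φ x) y :=
  neg_injective (h.contact x y)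

theorem phi_xi (h : IsSasakianStructure B φ ξ η) : φ ξ = 0 := by
  have hs := h.almostContactMetric.sq
  have h1 : φ (φ ξ) = 0 := by rw [hs, h.almostContactMetric.reeb, one_smul, neg_add_cancel]
  have h2 := hs (φ ξ)
  rw [h1, map_zero] at h2
  have h3 : φ ξ = η (φ ξ) • ξ := by linear_combination (norm := module) h2
  have h4 : η (φ ξ) • φ ξ = 0 := by rw [← map_smul, ← h3, h1]
  rcases smul_eq_zero.1 h4 with h5 | h5
  · rw [h3, h5, zero_smul]
  · exact h5

theorem eta_phi (h : IsSasakianStructure B φ ξ η) (x : g) : η (φ x) = 0 := by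
  have hs := h.almostContactMetric.sq
  have h1 := hs (φ x)
  rw [hs x, map_add, map_smul, h.phi_xi, map_neg, smul_zero, add_zero] at h1
  have h2 : η (φ x) • ξ = 0 := by linear_combination (norm := module) -h1
  have h3 := congrArg η h2
  simpa [h.almostContactMetric.reeb] using h3

theorem apply_xi (h : IsSasakianStructure B φ ξ η) (x : g) : B x ξ = η x := by
  have := h.almostContactMetric.compatible x ξ
  rw [h.phi_xi, map_zero, h.almostContactMetric.reeb] at this
  linarith

theorem apply_left (h : IsSasakianStructure B φ ξ η) (x y : g) : B (φ x) y = -B x (φ y) := by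
  rw [h.almostContactMetric.inner.symm x, ← h.eta_lie, ← h.eta_lie, ← lie_skew, map_neg]

theorem eta_lie_xi (h : IsSasakianStructure B φ ξ η) (x : g) : η ⁅ξ, x⁆ = 0 := by
  rw [h.eta_lie, h.phi_xi, map_zero, LinearMap.zero_apply]

theorem lie_xi_phi (h : IsSasakianStructure B φ ξ η) (x : g) : ⁅ξ, φ x⁆ = φ ⁅ξ, x⁆ := by
  have h1 := h.normal ξ x
  rw [h.phi_xi, zero_lie, zero_lie, zero_add, zero_add, dOne, h.eta_lie_xi] at h1
  have h2 := congrArg φ h1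
  simp only [map_sub, h.almostContactMetric.sq, h.eta_lie_xi, zero_smul, add_zero, map_neg,
    neg_zero, map_zero] at h2
  linear_combination (norm := module) h2

/-- On the image of `φ`, apply `η` to the Jacobi identity for `[ξ, [u, y]]`. The direction `ξ` is
harmless because `η = B(·, ξ)` vanishes on `[ξ, ·]`. -/
theorem lie_xi_skew (h : IsSasakianStructure B φ ξ η) (x y : g) :
    B ⁅ξ, x⁆ y + B x ⁅ξ, y⁆ = 0 := by
  have h1 (u : g) : B ⁅ξ, φ u⁆ y + B (φ u) ⁅ξ, y⁆ = 0 := by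
    have h2 := h.eta_lie_xi ⁅u, y⁆
    rwa [leibniz_lie, map_add, h.eta_lie, h.eta_lie, ← h.lie_xi_phi] at h2
  have h3 : x = φ (-φ x) + η x • ξ := by
    rw [map_neg, h.almostContactMetric.sq]; module
  rw [h3]
  simp only [lie_add, lie_smul, lie_self, smul_zero, add_zero, map_add, LinearMap.add_apply,
    map_smul, LinearMap.smul_apply]
  rw [h.almostContactMetric.inner.symm ξ, h.apply_xi, h.eta_lie_xi, smul_zero, add_zero]
  exact h1 _

variable [FiniteDimensional ℝ g]

/-- The Reeb vector of a solvable unimodular Sasakian Lie algebra is central. -/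
theorem central [LieAlgebra.IsSolvable g] (h : IsSasakianStructure B φ ξ η)
    (hu : IsUnimodular g) (x : g) : ⁅ξ, x⁆ = 0 := by
  have hB := h.almostContactMetric.inner
  obtain ⟨e, he⟩ := exists_isOrthonormalBasis hB.symm hB.pos
  set W := ∑ i, ⁅e i, φ (e i)⁆ with hW
  have htr (z : g) : LinearMap.trace ℝ g ((φ ∘ₗ φ) ∘ₗ LieAlgebra.ad ℝ g z) = 0 := by
    have h1 : φ ∘ₗ φ = -LinearMap.id + η.smulRight ξ :=
      LinearMap.ext h.almostContactMetric.sq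
    have h2 : η.smulRight ξ ∘ₗ LieAlgebra.ad ℝ g z =
        (η ∘ₗ LieAlgebra.ad ℝ g z).smulRight ξ := rfl
    rw [h1, LinearMap.add_comp, LinearMap.neg_comp, LinearMap.id_comp, map_add, map_neg, hu z, h2,
      LinearMap.trace_smulRight, LinearMap.comp_apply, LieAlgebra.ad_apply, ← lie_skew, map_neg,
      h.eta_lie_xi]
    simp
  have htr' (z : g) : LinearMap.trace ℝ g (φ ∘ₗ LieAlgebra.ad ℝ g z ∘ₗ φ) = 0 := by
    rw [LinearMap.trace_comp_comm', LinearMap.comp_assoc, LinearMap.trace_comp_comm', htr]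
  have hφW : φ W = 0 := by
    refine hB.nondegenerate.1 _ fun z => ?_
    have h1 := htr z
    have h2 := htr' z
    rw [he.trace_eq] at h1 h2
    -- Jacobi and `η [x, y] = B (φ x) y`; both resulting traces vanish by unimodularity.
    have h3 (i) : η ⁅⁅e i, φ (e i)⁆, z⁆ =
        B ((φ ∘ₗ LieAlgebra.ad ℝ g z ∘ₗ φ) (e i)) (e i) +
          B (((φ ∘ₗ φ) ∘ₗ LieAlgebra.ad ℝ g z) (e i)) (e i) := by
      rw [lie_lie, map_sub, h.eta_lie, h.eta_lie, ← lie_skew (φ (e i)), ← lie_skew (e i)]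
      simp only [LinearMap.comp_apply, LieAlgebra.ad_apply, h.apply_left, map_neg]
      rw [hB.symm (e i), hB.symm (e i)]
      simp only [h.apply_left, neg_neg]
      ring
    rw [← h.eta_lie, hW, sum_lie, map_sum, Finset.sum_congr rfl fun i _ => h3 i,
      Finset.sum_add_distrib, h1, h2, add_zero]
  have hWξ : η W • ξ = W := by
    have := h.almostContactMetric.sq W
    rw [hφW, map_zero] at this
    linear_combination (norm := module) -this
  have hηW : η W = ∑ i, B (φ (e i)) (φ (e i)) := by
    rw [hW, map_sum]
    exact Finset.sum_congr rfl fun i _ => h.eta_lie _ _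
  -- Since `η W` is the squared norm of `φ`, either `φ = 0` and `ξ` spans `g`, or `ξ` is a multiple
  -- of `W`.
  by_cases h0 : η W = 0
  · rw [hηW, Finset.sum_eq_zero_iff_of_nonneg fun i _ => hB.nonneg _] at h0
    have hφ : φ = 0 := e.ext fun i => by
      by_contra hne
      exact (hB.pos _ hne).ne' (h0 i (Finset.mem_univ _))
    have h1 := h.almostContactMetric.sq x
    rw [hφ, LinearMap.zero_apply] at h1
    have h2 : x = η x • ξ := by linear_combination (norm := module) h1
    rw [h2, lie_smul, lie_self, smul_zero]
  · have hmem : ξ ∈ commutatorSpan ℝ g := by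
      have h1 : ξ = (η W)⁻¹ • W := by rw [← hWξ, map_smul, smul_eq_mul,
        h.almostContactMetric.reeb, mul_one, smul_smul, inv_mul_cancel₀ h0, one_smul]
      rw [h1, hW]
      exact Submodule.smul_mem _ _ (Submodule.sum_mem _ fun i _ => lie_mem_commutatorSpan ℝ _ _)
    exact LinearMap.congr_fun (eq_zero_of_skew_of_isNilpotent hB.symm hB.pos
      (isNilpotent_ad_of_mem_commutatorSpan hmem) h.lie_xi_skew) x

/-- Transverse closedness is `η` of the Jacobi identity, and transverse integrability is normality
with its `ξ`-component removed. -/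
theorem isTransverseKaehler [LieAlgebra.IsSolvable g] (h : IsSasakianStructure B φ ξ η)
    (hu : IsUnimodular g) : IsTransverseKaehler φ B 0 ξ 0 η 1 where
  theta_lie := by simp
  theta_A := .inr ⟨rfl, rfl⟩
  eta_xi := .inl h.almostContactMetric.reeb
  eta_A := map_zero _
  theta_xi := rfl
  central := h.central hu
  eta_lie_A := by simp
  inner := h.almostContactMetric.inner
  lie_A_skew := by simp
  map_mem v _ := ⟨rfl, h.eta_phi v⟩
  sq v hv := by
    have h1 : η v = 0 := hv.2
    rw [h.almostContactMetric.sq, h1, zero_smul, add_zero]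
  compatible v hv w _ := by
    have h1 : η v = 0 := hv.2
    rw [h.almostContactMetric.compatible, h1, zero_mul, sub_zero]
  contact v _ w _ := by rw [h.eta_lie, one_mul]
  closed u _ v _ w _ := by
    simp only [map_sub, map_smul, h.phi_xi, smul_zero, sub_zero, ← h.eta_lie, ← map_add]
    have hj := lie_jacobi u v w
    rw [← lie_skew u ⁅v, w⁆, ← lie_skew v ⁅w, u⁆, ← lie_skew w ⁅u, v⁆] at hj
    have hj' : ⁅⁅u, v⁆, w⁆ + ⁅⁅v, w⁆, u⁆ + ⁅⁅w, u⁆, v⁆ = 0 := by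
      linear_combination (norm := module) -hj
    rw [hj', map_zero]
  integrable v hv w _ := by
    have h1 := h.normal v w
    have h2 : η v = 0 := hv.2
    have h3 : η ⁅φ v, φ w⁆ = η ⁅v, w⁆ := by
      rw [h.eta_lie, h.eta_lie, h.almostContactMetric.compatible, h.eta_phi, zero_mul, sub_zero]
    rw [h.almostContactMetric.sq, dOne] at h1
    rw [map_sub, map_smul, h.phi_xi, h3]
    linear_combination (norm := module) h1

end LieStr.IsSasakianStructure

end Structures

/-! ### Vaisman Lie algebras -/

section Vaisman

open Module LieStr

variable {g : Type*} [LieRing g] [LieAlgebra ℝ g]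

/-- A Vaisman structure with nonzero Lee form `θ`, where `A` is the vector metrically proportional
to `θ` with `θ A = 1`; parallelism of `θ` is recorded as skewness of `ad A`. -/
structure IsNormalizedVaisman (J : g →ₗ[ℝ] g) (B : LinearMap.BilinForm ℝ g) (θ : Dual ℝ g)
    (A : g) (a : ℝ) : Prop where
  hermitian : IsHermitianStructure J B
  lee : IsLeeForm J B θ
  theta_eq : ∀ x, θ x = a * B A x
  theta_A : θ A = 1
  lie_A_skew : ∀ x y, B ⁅A, x⁆ y + B x ⁅A, y⁆ = 0

theorem LieStr.IsHermitianStructure.isTransverseKaehler_of_lee_zero {J : g →ₗ[ℝ] g}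
    {B : LinearMap.BilinForm ℝ g} (h : IsHermitianStructure J B) (hl : IsLeeForm J B 0) :
    IsTransverseKaehler J B 0 0 0 0 0 where
  theta_lie := by simp
  theta_A := .inr ⟨rfl, rfl⟩
  eta_xi := .inr ⟨rfl, rfl⟩
  eta_A := rfl
  theta_xi := rfl
  central := by simp
  eta_lie_A := by simp
  inner := h.inner
  lie_A_skew := by simp
  map_mem v _ := ⟨rfl, rfl⟩
  sq v _ := h.complex.sq v
  compatible v _ w _ := h.compatible v w
  contact := by simp
  closed u _ v _ w _ := by
    have h1 := hl.lck u v w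
    simp only [dTwo, wedgeOneTwo, fundamentalForm, LinearMap.zero_apply, zero_mul, add_zero] at h1
    simp only [smul_zero, sub_zero]
    linarith
  integrable v _ w _ := by
    simp only [smul_zero, sub_zero]
    exact sub_eq_zero.1 (h.complex.integrable v w)

theorem LieStr.IsVaismanStructure.exists_normalized [FiniteDimensional ℝ g] {J : g →ₗ[ℝ] g}
    {B : LinearMap.BilinForm ℝ g} (h : IsVaismanStructure J B) :
    IsTransverseKaehler J B 0 0 0 0 0 ∨ ∃ θ A a, IsNormalizedVaisman J B θ A a := by
  obtain ⟨hh, θ, hl, hp⟩ := h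
  rcases eq_or_ne θ 0 with rfl | hθ
  · exact .inl (hh.isTransverseKaehler_of_lee_zero hl)
  · right
    set T := (B.toDual hh.inner.nondegenerate).symm θ with hT
    have hTx (x : g) : B T x = θ x :=
      LinearMap.BilinForm.apply_toDual_symm_apply (hB := hh.inner.nondegenerate) θ x
    have hT0 : T ≠ 0 := fun h0 => hθ (LinearMap.ext fun x => by rw [← hTx, h0]; simp)
    have ha := hh.inner.pos T hT0
    -- The Koszul formula for `∇θ = 0`, combined with `dθ = 0`, leaves exactly the symmetric part of
    -- `ad T`.
    have hskew (x y : g) : B ⁅T, x⁆ y + B x ⁅T, y⁆ = 0 := by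
      have h1 := hp y x
      have h2 := hl.closed y x
      rw [← hTx, hh.inner.symm, leviCivita_koszul, ← lie_skew x T, map_neg, LinearMap.neg_apply,
        hh.inner.symm _ T, hTx] at h1
      rw [dOne] at h2
      rw [hh.inner.symm x]
      linarith
    refine ⟨θ, (B T T)⁻¹ • T, B T T, hh, hl, fun x => ?_, ?_, fun x y => ?_⟩
    · rw [map_smul, LinearMap.smul_apply, smul_eq_mul, mul_inv_cancel_left₀ ha.ne', hTx]
    · rw [map_smul, ← hTx, smul_eq_mul, inv_mul_cancel₀ ha.ne']
    · simp only [smul_lie, map_smul, LinearMap.smul_apply, ← smul_add, hskew, smul_zero]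

namespace IsNormalizedVaisman

variable {J : g →ₗ[ℝ] g} {B : LinearMap.BilinForm ℝ g} {θ : Dual ℝ g} {A : g} {a : ℝ}

theorem a_ne_zero (h : IsNormalizedVaisman J B θ A a) : a ≠ 0 := by
  rintro rfl
  have := h.theta_eq A
  rw [h.theta_A, zero_mul] at this
  exact one_ne_zero this

theorem theta_lie (h : IsNormalizedVaisman J B θ A a) (x y : g) : θ ⁅x, y⁆ = 0 :=
  neg_eq_zero.1 (h.lee.closed x y)

theorem theta_J_A (h : IsNormalizedVaisman J B θ A a) : θ (J A) = 0 := by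
  have h1 := h.hermitian.apply_left A A
  rw [h.hermitian.inner.symm] at h1
  rw [h.theta_eq]
  have : B A (J A) = 0 := by linarith
  rw [this, mul_zero]

/-- The identity `dω = θ ∧ ω` at `(A, x, y)`. The last term measures the failure of `ad A` to
commute with `J`; `J_lie_A` removes it. -/
theorem lie_aux (h : IsNormalizedVaisman J B θ A a) (x y : g) :
    θ (J ⁅x, y⁆) = -a * B (J x) y - θ x * θ (J y) + θ y * θ (J x) -
      a * B (J ⁅A, x⁆ - ⁅A, J x⁆) y := by
  have h1 := h.lee.lck A x y
  have h2 := h.lie_A_skew (J x) y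
  have e (u : g) : a * B (J u) A = θ (J u) := by rw [h.theta_eq, h.hermitian.inner.symm]
  have e' (u : g) : a * B (J A) u = -θ (J u) := by
    rw [h.theta_eq, h.hermitian.apply_left, mul_neg]
  simp only [dTwo, wedgeOneTwo, fundamentalForm, h.theta_A] at h1
  have h3 : B (J ⁅y, A⁆) x = B (J x) ⁅A, y⁆ := by
    rw [h.hermitian.inner.symm, ← lie_skew, map_neg, map_neg, h.hermitian.apply_left]
  rw [h3] at h1
  have h4 := congrArg (a * ·) h1
  simp only [mul_sub, mul_add, mul_neg] at h4
  rw [map_sub, LinearMap.sub_apply]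
  linear_combination h4 * (-1) - e ⁅x, y⁆ - a * h2 - θ x * e y - θ y * e' x

theorem eta_lie_J (h : IsNormalizedVaisman J B θ A a) (x y : g) :
    θ (J ⁅J x, J y⁆) = θ (J ⁅x, y⁆) := by
  have h1 := congrArg (fun w => θ (J w)) (h.hermitian.complex.integrable x y)
  simp only [map_sub, map_zero, h.hermitian.complex.sq, map_neg, map_add, h.theta_lie] at h1
  linarith

/-- Replacing `x, y` by `J x, J y` in `lie_aux` preserves every term except the defect, which
changes sign. -/
theorem J_lie_A (h : IsNormalizedVaisman J B θ A a) (x : g) : ⁅A, J x⁆ = J ⁅A, x⁆ := by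
  symm
  rw [← sub_eq_zero]
  refine h.hermitian.inner.nondegenerate.1 _ fun y => ?_
  have hs := h.hermitian.complex.sq
  have h1 := h.lie_aux x y
  have h2 := h.lie_aux (J x) (J y)
  have h3 : B (J ⁅A, J x⁆ - ⁅A, J (J x)⁆) (J y) = -B (J ⁅A, x⁆ - ⁅A, J x⁆) y := by
    have h4 : J ⁅A, J x⁆ - ⁅A, J (J x)⁆ = -J (J ⁅A, x⁆ - ⁅A, J x⁆) := by
      rw [hs, lie_neg, map_sub, hs]; module
    rw [h4, map_neg, LinearMap.neg_apply, h.hermitian.compatible]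
  rw [h.eta_lie_J, h3, h.hermitian.compatible, hs, hs, map_neg, map_neg] at h2
  have h5 : a * B (J ⁅A, x⁆ - ⁅A, J x⁆) y = 0 := by linarith
  exact (mul_eq_zero.1 h5).resolve_left h.a_ne_zero

theorem eta_lie (h : IsNormalizedVaisman J B θ A a) (x y : g) :
    θ (J ⁅x, y⁆) = -a * B (J x) y - θ x * θ (J y) + θ y * θ (J x) := by
  rw [h.lie_aux, h.J_lie_A, sub_self, map_zero, LinearMap.zero_apply, mul_zero, sub_zero]

theorem eta_lie_J_A (h : IsNormalizedVaisman J B θ A a) (x : g) : θ (J ⁅J A, x⁆) = 0 := by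
  rw [h.eta_lie, h.theta_J_A, h.hermitian.complex.sq, map_neg, map_neg, LinearMap.neg_apply,
    h.theta_A, h.theta_eq x]
  ring

theorem lie_J_A_J (h : IsNormalizedVaisman J B θ A a) (x : g) : ⁅J A, J x⁆ = J ⁅J A, x⁆ := by
  have h1 := h.hermitian.complex.integrable A x
  rw [h.J_lie_A, map_add, h.hermitian.complex.sq] at h1
  linear_combination (norm := module) h1

/-- Apply `θ ∘ J` to the Jacobi identity for `[J A, [u, y]]`, using `eta_lie` and the surjectivity
of `J`. -/
theorem lie_J_A_skew (h : IsNormalizedVaisman J B θ A a) (x y : g) :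
    B ⁅J A, x⁆ y + B x ⁅J A, y⁆ = 0 := by
  have key (u : g) : B ⁅J A, J u⁆ y + B (J u) ⁅J A, y⁆ = 0 := by
    have h1 := h.eta_lie_J_A ⁅u, y⁆
    rw [leibniz_lie, map_add, map_add, h.eta_lie ⁅J A, u⁆ y, h.eta_lie u, h.theta_lie, h.theta_lie,
      h.eta_lie_J_A, h.eta_lie_J_A, ← h.lie_J_A_J] at h1
    have h2 : a * (B ⁅J A, J u⁆ y + B (J u) ⁅J A, y⁆) = 0 := by linear_combination -h1
    exact (mul_eq_zero.1 h2).resolve_left h.a_ne_zero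
  obtain ⟨u, rfl⟩ := h.hermitian.surjective x
  exact key u

variable [FiniteDimensional ℝ g]

/-- In a solvable unimodular Vaisman Lie algebra, `J A` is central for the Lee vector `A`. -/
theorem central [LieAlgebra.IsSolvable g] (h : IsNormalizedVaisman J B θ A a)
    (hu : IsUnimodular g) (x : g) : ⁅J A, x⁆ = 0 := by
  have hB := h.hermitian.inner
  have hs := h.hermitian.complex.sq
  have ha := h.a_ne_zero
  obtain ⟨e, he⟩ := exists_isOrthonormalBasis hB.symm hB.pos
  set W := ∑ i, ⁅e i, J (e i)⁆ with hW
  set N := ∑ i, B (e i) (e i) with hN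
  have hθ (x : g) : a * B A x = θ x := (h.theta_eq x).symm
  have hη (x : g) : a * B (J A) x = -θ (J x) := by
    rw [h.theta_eq, h.hermitian.apply_left, mul_neg]
  have hsumθ (z : g) : ∑ i, θ (e i) * B (e i) z = θ z := by
    simp only [← hθ, mul_assoc, ← Finset.mul_sum, hB.symm _ z, he.sum_mul]
  have hsumη (z : g) : ∑ i, θ (J (e i)) * B (J z) (e i) = -θ z := by
    have h1 (i) : θ (J (e i)) = -(a * B (J A) (e i)) := by rw [hη, neg_neg]
    simp only [h1, neg_mul, mul_assoc, Finset.sum_neg_distrib, ← Finset.mul_sum, he.sum_mul,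
      h.hermitian.compatible, hθ]
  -- Trace `dω = θ ∧ ω` over the pairs `e i, J (e i)`. Here `N` is the dimension of `g`; the `2`
  -- comes from `hsumθ` and `hsumη`.
  have hJW (z : g) : B (J W) z = -(N - 2) * θ z := by
    have h1 := hu z
    have h2 : LinearMap.trace ℝ g (J ∘ₗ LieAlgebra.ad ℝ g z ∘ₗ J) = 0 := by
      rw [LinearMap.trace_comp_comm', LinearMap.comp_assoc]
      have : J ∘ₗ J = -LinearMap.id := LinearMap.ext hs
      rw [this, LinearMap.comp_neg, LinearMap.comp_id, map_neg, h1, neg_zero]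
    rw [he.trace_eq] at h1 h2
    have h3 (i) : B (J ⁅e i, J (e i)⁆) z =
        B ((J ∘ₗ LieAlgebra.ad ℝ g z ∘ₗ J) (e i)) (e i) - B (LieAlgebra.ad ℝ g z (e i)) (e i) +
          θ (e i) * B (e i) z - θ (J (e i)) * B (J z) (e i) - θ z * B (e i) (e i) := by
      have h4 := h.lee.lck (e i) (J (e i)) z
      simp only [dTwo, wedgeOneTwo, fundamentalForm, hs] at h4
      rw [h.hermitian.compatible ⁅z, e i⁆, h.hermitian.compatible (e i),
        ← lie_skew (J (e i)) z] at h4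
      simp only [map_neg, LinearMap.neg_apply] at h4
      simp only [LinearMap.comp_apply, LieAlgebra.ad_apply]
      linarith
    simp only [hW, map_sum, LinearMap.sum_apply, h3, Finset.sum_sub_distrib,
      Finset.sum_add_distrib, h1, h2, hsumθ, hsumη, ← Finset.mul_sum, ← hN]
    ring
  have hWA : W = ((N - 2) * a) • J A := by
    have h1 : J (W - ((N - 2) * a) • J A) = 0 := by
      refine hB.nondegenerate.1 _ fun z => ?_
      simp only [map_sub, map_smul, hs, LinearMap.sub_apply, LinearMap.smul_apply, smul_eq_mul,
        hJW, map_neg, LinearMap.neg_apply, ← hθ]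
      ring
    have h2 := hs (W - ((N - 2) * a) • J A)
    rw [h1, map_zero] at h2
    exact sub_eq_zero.1 (neg_eq_zero.1 h2.symm)
  by_cases h0 : N = 2
  -- `Q` projects orthogonally off `A` and `J A`. Its squared norm is `N - 2 = 0`, so `g` is spanned
  -- by these two commuting vectors.
  · let Q : g →ₗ[ℝ] g := LinearMap.id - θ.smulRight A + (θ ∘ₗ J).smulRight (J A)
    have hQ (x : g) : Q x = x - θ x • A + θ (J x) • J A := rfl
    have hQQ (x : g) : a * B (Q x) (Q x) =
        a * B x x - θ x * (a * B A x) + θ (J x) * (a * B (J A) x) := by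
      have e1 := hθ A
      have e2 := hθ (J A)
      rw [h.theta_A] at e1
      rw [h.theta_J_A] at e2
      simp only [hQ, map_sub, map_add, map_smul, LinearMap.sub_apply, LinearMap.add_apply,
        LinearMap.smul_apply, smul_eq_mul, h.hermitian.compatible, hB.symm x A, hB.symm x (J A),
        hB.symm (J A) A]
      linear_combination (θ x ^ 2 + θ (J x) ^ 2) * e1 - 2 * θ x * θ (J x) * e2 -
        θ x * hθ x + θ (J x) * hη x
    have hsum : a * ∑ i, B (Q (e i)) (Q (e i)) = 0 := by
      have e1 := hsumθ A
      have e2 := hsumη A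
      rw [h.theta_A] at e1 e2
      simp only [Finset.mul_sum, hQQ, Finset.sum_add_distrib, Finset.sum_sub_distrib]
      have e3 : ∑ i, θ (e i) * (a * B A (e i)) = a := by
        simp only [mul_left_comm _ a, hB.symm A, ← Finset.mul_sum, e1, mul_one]
      have e4 : ∑ i, θ (J (e i)) * (a * B (J A) (e i)) = -a := by
        simp only [mul_left_comm _ a, ← Finset.mul_sum, e2, mul_neg, mul_one]
      rw [e3, e4, ← Finset.mul_sum, ← hN, h0]
      ring
    have hsum' := (mul_eq_zero.1 hsum).resolve_left ha
    rw [Finset.sum_eq_zero_iff_of_nonneg fun i _ => hB.nonneg _] at hsum'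
    have hQ0 : Q = 0 := e.ext fun i => by
      by_contra hne
      exact (hB.pos _ hne).ne' (hsum' i (Finset.mem_univ _))
    have h1 := hQ x
    rw [hQ0, LinearMap.zero_apply] at h1
    have h2 : x = θ x • A - θ (J x) • J A := by linear_combination (norm := module) -h1
    have h3 : ⁅J A, A⁆ = 0 := by rw [← lie_skew, h.J_lie_A, lie_self, map_zero, neg_zero]
    rw [h2, lie_sub, lie_smul, lie_smul, lie_self, h3, smul_zero, smul_zero, sub_zero]
  · have hmem : J A ∈ commutatorSpan ℝ g := by
      have h1 : J A = ((N - 2) * a)⁻¹ • W := by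
        rw [hWA, smul_smul, inv_mul_cancel₀ (mul_ne_zero (sub_ne_zero.2 h0) ha), one_smul]
      rw [h1, hW]
      exact Submodule.smul_mem _ _ (Submodule.sum_mem _ fun i _ => lie_mem_commutatorSpan ℝ _ _)
    exact LinearMap.congr_fun (eq_zero_of_skew_of_isNilpotent hB.symm hB.pos
      (isNilpotent_ad_of_mem_commutatorSpan hmem) h.lie_J_A_skew) x

/-- The sign `ξ = -J A` gives `η ξ = θ A = 1`, and `c = -a` is read off `eta_lie`. Projecting
brackets along `ξ` keeps the form closed, since `J ξ = A` is orthogonal to the transverse space. -/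
theorem isTransverseKaehler [LieAlgebra.IsSolvable g] (h : IsNormalizedVaisman J B θ A a)
    (hu : IsUnimodular g) : IsTransverseKaehler J B A (-J A) θ (θ ∘ₗ J) (-a) where
  theta_lie := h.theta_lie
  theta_A := .inl h.theta_A
  eta_xi := .inl (by simp [h.hermitian.complex.sq, h.theta_A])
  eta_A := h.theta_J_A
  theta_xi := by rw [map_neg, h.theta_J_A, neg_zero]
  central x := by rw [neg_lie, h.central hu, neg_zero]
  eta_lie_A x := by
    rw [LinearMap.comp_apply, ← h.J_lie_A, h.theta_lie]
  inner := h.hermitian.inner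
  lie_A_skew := h.lie_A_skew
  map_mem v hv := by
    have h1 : θ v = 0 := hv.1
    exact ⟨hv.2, by simp [h.hermitian.complex.sq, h1]⟩
  sq v _ := h.hermitian.complex.sq v
  compatible v _ w _ := h.hermitian.compatible v w
  contact v hv w hw := by
    have h1 : θ v = 0 := hv.1
    have h2 : θ w = 0 := hw.1
    rw [LinearMap.comp_apply, h.eta_lie, h1, h2]
    ring
  closed u hu' v hv w hw := by
    have e (x : g) (hx : x ∈ TransverseSpace θ (θ ∘ₗ J)) : B A x = 0 := by
      have h1 : θ x = 0 := hx.1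
      rw [h.theta_eq] at h1
      exact (mul_eq_zero.1 h1).resolve_left h.a_ne_zero
    have h1 := h.lee.lck u v w
    have hu0 : θ u = 0 := hu'.1
    have hv0 : θ v = 0 := hv.1
    have hw0 : θ w = 0 := hw.1
    simp only [dTwo, wedgeOneTwo, fundamentalForm, hu0, hv0, hw0, zero_mul, add_zero] at h1
    simp only [map_sub, map_smul, map_neg, h.hermitian.complex.sq, LinearMap.sub_apply,
      LinearMap.smul_apply, neg_neg, e u hu', e v hv, e w hw, smul_zero, sub_zero]
    linarith
  integrable v hv w hw := by
    have hv0 : θ v = 0 := hv.1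
    have hw0 : θ w = 0 := hw.1
    have hv1 : θ (J v) = 0 := hv.2
    have hw1 : θ (J w) = 0 := hw.2
    have h1 := h.hermitian.complex.integrable v w
    have h2 : θ (J (⁅J v, w⁆ + ⁅v, J w⁆)) = 0 := by
      rw [map_add, map_add, h.eta_lie, h.eta_lie, h.hermitian.compatible, h.hermitian.complex.sq,
        hv0, hw0, hv1, hw1, map_neg, LinearMap.neg_apply]
      ring
    simp only [LinearMap.comp_apply]
    rw [h2, zero_smul, sub_zero, h.eta_lie_J]
    linear_combination (norm := module) h1

end IsNormalizedVaisman

end Vaisman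

theorem mainTheorem6 {g : Type*} [LieRing g] [LieAlgebra ℝ g] [FiniteDimensional ℝ g]
    (hsolv : LieAlgebra.IsSolvable g) (hunim : LieStr.IsUnimodular g) :
    ((∃ (J : g →ₗ[ℝ] g) (B : LinearMap.BilinForm ℝ g), LieStr.IsVaismanStructure J B) →
      ∃ m : g →ₗ[ℝ] g →ₗ[ℝ] g, LieStr.IsCompleteLSAStructure m) ∧
    ((∃ (B : LinearMap.BilinForm ℝ g) (φ : g →ₗ[ℝ] g) (ξ : g) (η : Module.Dual ℝ g),
        LieStr.IsSasakianStructure B φ ξ η) →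
      ∃ m : g →ₗ[ℝ] g →ₗ[ℝ] g, LieStr.IsCompleteLSAStructure m) := by
  refine ⟨fun ⟨J, B, h⟩ => ?_, fun ⟨B, φ, ξ, η, h⟩ =>
    (h.isTransverseKaehler hunim).exists_isCompleteLSAStructure hunim⟩
  rcases h.exists_normalized with h | ⟨θ, A, a, h⟩
  · exact h.exists_isCompleteLSAStructure hunim
  · exact (h.isTransverseKaehler hunim).exists_isCompleteLSAStructure hunim
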